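/- **Theorem (RCUs–PAT–ML achievability bound).** *Channel and codes.* Let $\kappa\ge 0$, $\mu_H=\sqrt{\kappa/(1+\kappa)}$, $\sigma_H^2=1/(1+\kappa)$, and let $\ell\ge 1$, $n_c\ge 1$. Consider the block-fading channel $Y_k=H_kx_k+W_k$, $k=1,\dots,\ell$, with $x_k\in\mathbb C^{n_c}$ and independent $H_k\sim\mathcal{CN}(\mu_H,\sigma_H^2)$, $W_k\sim\mathcal{CN}(0,I_{n_c})$. An $(\ell,n_c,M,\epsilon,\rho)$-code has $M$ codewords $c_m=[c_{m,1},\dots,c_{m,\ell}]$ with $\|c_{m,k}\|^2=n_c\rho$ for all $m,k$, and a decoder $g:\mathbb C^{n_c\ell}\to\{1,\dots,M\}$ with average error probability (over equiprobable messages) at most $\epsilon$. Let $R^*(\ell,n_c,\epsilon,\rho)$ be the supremum (in $[-\infty,\infty]$) of $\frac{\log_2M}{\ell n_c}$ over all $M$ for which such a code exists. *Pilots.* Fix integers $n_p\ge0$ and $n_d=n_c-n_p\ge1$ and reals $\rho_p,\rho_d\ge0$ with $n_p\rho_p+n_d\rho_d=n_c\rho$. In each block a pilot vector $x^{(p)}_k\in\mathbb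 C^{n_p}$, whose entries have squared modulus $\rho_p$, is sent, followed by a data vector $x^{(d)}_k\in\mathbb C^{n_d}$ with $\|x_k^{(d)}\|^2=n_d\rho_d$. With $y_k^{(p)},y_k^{(d)}$ the corresponding parts of the received vector, the receiver forms $\hat h_k=(x_k^{(p)})^{\mathsf H}y_k^{(p)}/\|x_k^{(p)}\|^2$. Put $$\mu_p(\hat h)=\frac{\sigma_H^2\hat h+(n_p\rho_p)^{-1}\mu_H}{\sigma_H^2+(n_p\rho_p)^{-1}},\qquad \sigma_p^2=\frac{\sigma_H^2(n_p\rho_p)^{-1}}{\sigma_H^2+(n_p\rho_p)^{-1}},$$ and $\mu_p=\mu_H$, $\sigma_p^2=\sigma_H^2$ if $n_p\rho_p=0$ (no channel estimate; $\hat h_k:=0$). *Bound.* For $s>0$, $\hat h\in\mathbb C$ and $w\in\mathbb C^{n_d}$, let $\tilde w=\tilde w(\hat h,w)$ have first entry $\mu_p(\hat h)\sqrt{n_d\rho_d}+\sqrt{\sigma_p^2n_d\rho_d+1}\;w_1$ and other entries $w_2,\dots,w_{n_d}$, and let $$\begin{aligned}\bar S^s(\hat h,w)={}&(n_d-2)\log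 s-\log\frac{1+\sigma_p^2n_d\rho_d}{\sigma_p^2}-\log\Gamma(n_d)-s\big(\|w\|^2-\|\tilde w\|^2\big)+\frac{s|\mu_p(\hat h)|^2}{\sigma_p^2}\\&-\log\int_0^\infty e^{-s(\rho_dn_d+\sigma_p^{-2})z}\,\frac{I_{n_d-1}\big(2s\|\tilde w\|\sqrt{\rho_dn_dz}\big)}{\big(\|\tilde w\|\sqrt{\rho_dn_dz}\big)^{n_d-1}}\,I_0\Big(2s\sigma_p^{-2}\sqrt{z|\mu_p(\hat h)|^2}\Big)\,dz,\end{aligned}$$ where $I_\nu$ is the modified Bessel function of the first kind, the quotient $I_{\nu}(2sa)/a^{\nu}$ is read as its limit $s^{\nu}/\nu!$ at $a=0$, and $\bar S^0:=0$. Let $$\epsilon_{ub}(M)=\inf_{s\ge0}\mathbb E\Big[\exp\Big\{-\Big[\sum_{k=1}^\ell\bar S^s(\hat H_k,W_k)-\log(M-1)\Big]^+\Big\}\Big],$$ where $\hat H_k\sim\mathcal{CN}\big(\mu_H,\sigma_H^2+(n_p\rho_p)^{-1}\big)$ and $W_k\sim\mathcal{CN}(0,I_{n_d})$ are all independent, $[a]^+=\max\{0,a\}$,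 and $\log 0=-\infty$, so that $\epsilon_{ub}(1)=0$. (If $n_p\rho_p=0$ the law of $\hat H_k$ is immaterial.) *Claims.* 1. If $n_p\rho_p>0$, then $\hat H_k\sim\mathcal{CN}(\mu_H,\sigma_H^2+(n_p\rho_p)^{-1})$. In all cases, given $\hat H_k=\hat h$ and the data vector $x$, the conditional law of $Y_k^{(d)}$ is, for almost every $\hat h$ with respect to the law of $\hat H_k$, that of $Z x+W$ with independent $Z\sim\mathcal{CN}(\mu_p(\hat h),\sigma_p^2)$ and $W\sim\mathcal{CN}(0,I_{n_d})$. The latter law has the density $q(x,\cdot\mid\hat h)$ of $\mathcal{CN}\big(\mu_p(\hat h)x,\ \sigma_p^2xx^{\mathsf H}+I_{n_d}\big)$. 2. For every $M\ge1$ and all pilot vectors as above there is a code with $M$ messages that uses these pilots and data vectors with $\|x_k^{(d)}\|^2=n_d\rho_d$, whose decoder maximizes $\prod_{k}q\big(c^{(d)}_{m,k},y^{(d)}_k\mid\hat h_k\big)$ over $m$, and whose average error probability is at most $\epsilon_{ub}(M)$. 3. For every real $\epsilon$, $$R^*(\ell,n_c,\epsilon,\rho)\ \ge\ \sup\Big\{\frac{\log_2M}{n_c\ell}:\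 M\ge1,\ \epsilon_{ub}(M)\le\epsilon\Big\}.$$ -/

import Mathlib

open MeasureTheory ProbabilityTheory
open scoped NNReal

noncomputable section

namespace RicianPAT

/-! ### Complex Gaussian laws -/

/-- The circularly-symmetric complex Gaussian law `CN(m, v)` on `ℂ`: real and imaginary parts are
independent real Gaussians with means `m.re`, `m.im` and variance `v / 2` each. -/
def cgauss (m : ℂ) (v : ℝ) : Measure ℂ :=
  ((gaussianReal m.re (v / 2).toNNReal).prod (gaussianReal m.im (v / 2).toNNReal)).map
    Complex.measurableEquivRealProd.symm

/-- The law `CN(0, I_n)` on `ℂⁿ`. -/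
def noiseLaw (n : ℕ) : Measure (Fin n → ℂ) :=
  Measure.pi fun _ => cgauss 0 1

instance (m : ℂ) (v : ℝ) : IsProbabilityMeasure (cgauss m v) :=
  Measure.isProbabilityMeasure_map Complex.measurableEquivRealProd.symm.measurable.aemeasurable

instance (n : ℕ) : IsProbabilityMeasure (noiseLaw n) := by
  unfold noiseLaw; infer_instance

/-- The squared `ℓ²` norm of a vector of `ℂⁿ`. -/
def normSq {n : ℕ} (x : Fin n → ℂ) : ℝ := ∑ i, ‖x i‖ ^ 2

/-- The density of `CN(m, Σ)` on `ℂⁿ` for a Hermitian positive definite covariance matrix `Σ`: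
`exp(-(y - m)ᴴ Σ⁻¹ (y - m)) / (πⁿ det Σ)`. -/
def cgaussPdf {n : ℕ} (m : Fin n → ℂ) (S : Matrix (Fin n) (Fin n) ℂ) (y : Fin n → ℂ) : ℝ :=
  Real.exp (-(star (y - m) ⬝ᵥ S⁻¹.mulVec (y - m)).re) / (Real.pi ^ n * S.det.re)

/-! ### The Rician memoryless block-fading channel, codes, and the maximum coding rate -/

/-- Mean of the fading coefficient for the Rician factor `κ`. -/
def muH (κ : ℝ) : ℝ := Real.sqrt (κ / (1 + κ))

/-- Variance of the fading coefficient for the Rician factor `κ`. -/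
def varH (κ : ℝ) : ℝ := (1 + κ)⁻¹

/-- Law of `(H, W)` in one coherence block of length `n`. -/
def blockLaw (κ : ℝ) (n : ℕ) : Measure (ℂ × (Fin n → ℂ)) :=
  (cgauss (muH κ) (varH κ)).prod (noiseLaw n)

instance (κ : ℝ) (n : ℕ) : IsProbabilityMeasure (blockLaw κ n) := by
  unfold blockLaw; infer_instance

/-- Law of the channel output `(H_k x_k + W_k)_{k = 1, …, ℓ}` when `x` is transmitted; the pairs
`(H_k, W_k)` are independent over `k`. -/
def outputLaw (κ : ℝ) {ℓ n : ℕ} (x : Fin ℓ → Fin n → ℂ) : Measure (Fin ℓ → Fin n → ℂ) :=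
  (Measure.pi fun _ : Fin ℓ => blockLaw κ n).map
    fun ω k i => (ω k).1 * x k i + (ω k).2 i

/-- Encoder and decoder for `M` messages over `ℓ` coherence blocks of length `n`, where every
subcodeword satisfies the power constraint `‖c_{m,k}‖² = n ρ`. -/
structure BlockCode (ℓ n M : ℕ) (ρ : ℝ) where
  enc : Fin M → Fin ℓ → Fin n → ℂ
  power : ∀ m k, normSq (enc m k) = n * ρ
  dec : (Fin ℓ → Fin n → ℂ) → Fin M
  measurable_dec : Measurable dec

/-- Average error probability of a code, for equiprobable messages. -/
def avgError (κ : ℝ) {ℓ n M : ℕ} {ρ : ℝ} (c : BlockCode ℓ n M ρ) : ℝ :=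
  (1 / (M : ℝ)) * ∑ j, (outputLaw κ (c.enc j)).real {y | c.dec y ≠ j}

/-- The maximum coding rate `R*(ℓ, n, ε, ρ)` in bits per channel use. The supremum is taken in the
extended reals. -/
def maxRate (κ : ℝ) (ℓ n : ℕ) (ε ρ : ℝ) : EReal :=
  sSup {r : EReal | ∃ (M : ℕ) (c : BlockCode ℓ n M ρ), avgError κ c ≤ ε ∧
    r = ((Real.logb 2 M / (ℓ * n) : ℝ) : EReal)}

/-! ### Pilot-assisted transmission: the first `np` symbols of a block are pilots -/

/-- The pilot part of a block. -/
def pilotPart {np nd : ℕ} (y : Fin (np + nd) → ℂ) : Fin np → ℂ := fun i => y (Fin.castAdd nd i)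

/-- The data part of a block. -/
def dataPart {np nd : ℕ} (y : Fin (np + nd) → ℂ) : Fin nd → ℂ := fun i => y (Fin.natAdd np i)

/-- Maximum-likelihood estimate `(xᵖ)ᴴ yᵖ / ‖xᵖ‖²` of the fading coefficient (it is `0` when there
is no pilot energy, that is, when no estimate is available). -/
def mlEstimate {np : ℕ} (xp yp : Fin np → ℂ) : ℂ := (star xp ⬝ᵥ yp) / (normSq xp : ℂ)

/-- `μ_p(ĥ)`, as a function of the total pilot energy `e = n_p ρ_p`; for `e = 0` it is the limit
`μ_H`. -/
def muP (κ e : ℝ) (h : ℂ) : ℂ :=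
  if e = 0 then (muH κ : ℂ)
  else ((varH κ : ℂ) * h + ((e⁻¹ : ℝ) : ℂ) * (muH κ : ℂ)) / ((varH κ + e⁻¹ : ℝ) : ℂ)

/-- `σ_p²`, as a function of the total pilot energy `e = n_p ρ_p`; for `e = 0` it is the limit
`σ_H²`. -/
def varP (κ e : ℝ) : ℝ :=
  if e = 0 then varH κ else varH κ * e⁻¹ / (varH κ + e⁻¹)

/-- Law of the output `Z x + W` of the equivalent Rician channel, where `Z ∼ CN(μ_p(ĥ), σ_p²)` and
`W ∼ CN(0, I)` are independent. -/
def eqChannelLaw (κ e : ℝ) {n : ℕ} (h : ℂ) (x : Fin n → ℂ) : Measure (Fin n → ℂ) :=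
  ((cgauss (muP κ e h) (varP κ e)).prod (noiseLaw n)).map fun ω i => ω.1 * x i + ω.2 i

/-- The decoding metric for the data part: the density of `CN(μ_p(ĥ) x, σ_p² x xᴴ + I)` at `y`. -/
def mlMetric (κ e : ℝ) {n : ℕ} (h : ℂ) (x y : Fin n → ℂ) : ℝ :=
  cgaussPdf (fun i => muP κ e h * x i)
    ((varP κ e : ℂ) • Matrix.vecMulVec x (star x) + 1) y

/-- The code sends the pilot vectors `xp k` in the first `np` channel uses of block `k`, and data
vectors with `‖xᵈ‖² = n_d ρ_d` in the other `nd`. -/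
def IsPilotAssisted {ℓ np nd M : ℕ} {ρ : ℝ} (c : BlockCode ℓ (np + nd) M ρ)
    (xp : Fin ℓ → Fin np → ℂ) (ρd : ℝ) : Prop :=
  ∀ m k, pilotPart (c.enc m k) = xp k ∧ normSq (dataPart (c.enc m k)) = nd * ρd

/-- The decoder computes the estimates `ĥ_k` from the pilots and maximizes the product over the
blocks of the metrics given these estimates. -/
def IsMLGivenEstimate (κ e : ℝ) {ℓ np nd M : ℕ} {ρ : ℝ} (c : BlockCode ℓ (np + nd) M ρ)
    (xp : Fin ℓ → Fin np → ℂ) : Prop :=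
  ∀ y m,
    ∏ k, mlMetric κ e (mlEstimate (xp k) (pilotPart (y k)))
        (dataPart (c.enc m k)) (dataPart (y k)) ≤
      ∏ k, mlMetric κ e (mlEstimate (xp k) (pilotPart (y k)))
        (dataPart (c.enc (c.dec y) k)) (dataPart (y k))

/-! ### The bound -/

/-- The modified Bessel function of the first kind `I_ν` of integer order `ν ≥ 0`. -/
def besselI (ν : ℕ) (x : ℝ) : ℝ :=
  ∑' k : ℕ, (x / 2) ^ (2 * k + ν) / ((k.factorial : ℝ) * ((k + ν).factorial : ℝ))

/-- `I_ν(2 s a) / a^ν`, with its limit `s^ν / ν!` at `a = 0`. -/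
def besselQuot (ν : ℕ) (s a : ℝ) : ℝ :=
  if a = 0 then s ^ ν / (ν.factorial : ℝ) else besselI ν (2 * s * a) / a ^ ν

/-- The vector `w̃`: the first entry of `w` is scaled by `√(v n ρ + 1)` and shifted by
`μ √(n ρ)`. -/
def wTilde {n : ℕ} (ρ : ℝ) (μ : ℂ) (v : ℝ) (w : Fin n → ℂ) : Fin n → ℂ := fun i =>
  if i.val = 0 then
    μ * (Real.sqrt (n * ρ) : ℂ) + (Real.sqrt (v * n * ρ + 1) : ℂ) * w i
  else w i

/-- The random variable `S^s` for block length `n`, power `ρ`, and fading law `CN(μ, v)`, as a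
function of the noise realization `w`. At `s = 0` it is the limit `0`. -/
def infoDens {n : ℕ} (ρ : ℝ) (μ : ℂ) (v s : ℝ) (w : Fin n → ℂ) : ℝ :=
  if s = 0 then 0 else
    ((n : ℝ) - 2) * Real.log s - Real.log ((1 + v * n * ρ) / v) - Real.log (Real.Gamma n)
      - s * (normSq w - normSq (wTilde ρ μ v w)) + s * ‖μ‖ ^ 2 / v
      - Real.log (∫ z in Set.Ioi (0 : ℝ),
          Real.exp (-(s * (ρ * n + v⁻¹) * z))
            * besselQuot (n - 1) s (Real.sqrt (normSq (wTilde ρ μ v w)) * Real.sqrt (ρ * n * z))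
            * besselI 0 (2 * s * v⁻¹ * Real.sqrt (z * ‖μ‖ ^ 2)))

/-- `exp(-[i - log(M - 1)]⁺)`, where `log 0 = -∞`, so that the value is `0` for `M = 1`. -/
def rcusTerm (M : ℕ) (i : ℝ) : ℝ :=
  if M ≤ 1 then 0 else Real.exp (-max 0 (i - Real.log ((M : ℝ) - 1)))

/-- Joint law of the estimates `Ĥ_k ∼ CN(μ_H, σ_H² + (n_p ρ_p)⁻¹)` and of the noise vectors
`W_k ∼ CN(0, I_{n_d})`, all independent, with `e = n_p ρ_p`. (For `e = 0` the law of the estimates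
is irrelevant, since `μ_p` is then constant.) -/
def estimateNoiseLaw (κ e : ℝ) (ℓ nd : ℕ) : Measure (Fin ℓ → ℂ × (Fin nd → ℂ)) :=
  Measure.pi fun _ => (cgauss (muH κ) (varH κ + e⁻¹)).prod (noiseLaw nd)

/-- The bound `ε_ub` on the error probability. -/
def epsUb (κ : ℝ) (ℓ np nd M : ℕ) (ρp ρd : ℝ) : ℝ :=
  ⨅ s : ℝ≥0, ∫ ω, rcusTerm M
      (∑ k, infoDens ρd (muP κ (np * ρp) (ω k).1) (varP κ (np * ρp)) s (ω k).2)
    ∂(estimateNoiseLaw κ (np * ρp) ℓ nd)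

end RicianPAT

end

open RicianPAT

noncomputable section

namespace RicianPAT

open scoped ENNReal

/-! ### Products over finite index types -/

/-! The argument is random coding with codewords whose data parts are independent and uniform on
spheres, and everything rests on unitary invariance of Gaussian noise.

Channel given the estimate. The estimate is the fading coefficient plus independent Gaussian noise.
A rotation of `ℂ²` makes this sum independent of the residual in the linear estimation of the fading
from it (`cgauss_prod_map_add_residual`). Hence, given the estimate, the data part sees Rician
fading with parameters `muP`, `varP`, and the ML metric is the density of that channel, by
completing a square (`complete_square`).

Error probability. An error requires a competitor whose metric is at least that of the sent
codeword. For each channel output the union bound, truncated at one, is averaged over the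
competitors (`random_coding_union_bound`). Markov's inequality for the `s`-th power of the ratio of
metrics bounds the pairwise probability by a product over blocks of `metricRatio`
(`measure_codeMetric_le`).

Evaluation. The average over the sphere of the `s`-th power of the metric is computed by writing
that power as a Gaussian integral over a fading variable `z` and exchanging integrals. The sphere
average gives `I_{n-1}`, the phase of `z` gives `I_0`, and the squared modulus of `z` remains as the
integration variable of the bound (`lintegral_sphereLaw_metric`). By unitary invariance the sent
codeword may be placed on the first axis, where the output has the law of `wTilde`. So each ratio is
distributed as `exp (-S)` with `S` the information density (`ofReal_exp_neg_infoDens`,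
`fadingLaw_map_metricRatio`).

Some codebook does at least as well as the ensemble average (`exists_codebook`), which yields the
code, and the rate bound follows. -/

lemma lintegral_pi_prod {α : Type*} [MeasurableSpace α] (n : ℕ) (μ : Fin n → Measure α)
    [∀ i, SigmaFinite (μ i)] (f : Fin n → α → ℝ≥0∞) (hf : ∀ i, Measurable (f i)) :
    ∫⁻ x, ∏ i, f i (x i) ∂(Measure.pi μ) = ∏ i, ∫⁻ x, f i x ∂(μ i) := by
  induction n with
  | zero => simp
  | succ n ih =>
    have h1 := ((measurePreserving_piFinSuccAbove μ 0).symm).lintegral_comp_emb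
      (MeasurableEquiv.measurableEmbedding _) (fun x => ∏ i, f i (x i))
    rw [← h1]
    simp_rw [MeasurableEquiv.piFinSuccAbove_symm_apply, Fin.insertNthEquiv,
            Fin.prod_univ_succ, Fin.insertNth_zero, Equiv.coe_fn_mk, Fin.cons_succ,
            Fin.zero_succAbove, Fin.cons_zero]
    rw [← ih (fun i => μ i.succ) (fun i => f i.succ) (fun i => hf _),
      ← lintegral_prod_mul (hf 0).aemeasurable]
    · rfl
    · exact (Finset.measurable_prod _ fun i _ =>
        (hf _).comp (measurable_pi_apply i)).aemeasurable

lemma pi_withDensity_eq {α : Type*} [MeasurableSpace α] {n : ℕ} (μ : Measure α) [SigmaFinite μ]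
    (f : α → ℝ≥0∞) (hf : Measurable f) [SigmaFinite (μ.withDensity f)] :
    Measure.pi (fun _ : Fin n => μ.withDensity f) =
      (Measure.pi (fun _ : Fin n => μ)).withDensity fun x => ∏ i, f (x i) := by
  refine Measure.pi_eq fun s hs => ?_
  rw [withDensity_apply _ (MeasurableSet.univ_pi hs), ← lintegral_indicator
    (MeasurableSet.univ_pi hs)]
  have h : ∀ x : Fin n → α, (Set.univ.pi s).indicator (fun x => ∏ i, f (x i)) x
      = ∏ i, (s i).indicator f (x i) := by
    intro x
    by_cases hx : x ∈ Set.univ.pi s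
    · rw [Set.indicator_of_mem hx]
      exact Finset.prod_congr rfl fun i _ => (Set.indicator_of_mem (hx i trivial) f).symm
    · rw [Set.indicator_of_notMem hx]
      simp only [Set.mem_pi, Set.mem_univ, true_implies, not_forall] at hx
      obtain ⟨i, hi⟩ := hx
      exact (Finset.prod_eq_zero (Finset.mem_univ i) (Set.indicator_of_notMem hi f)).symm
  simp_rw [h]
  rw [lintegral_pi_prod n _ (fun i => (s i).indicator f) fun i => hf.indicator (hs i)]
  refine Finset.prod_congr rfl fun i _ => ?_
  rw [lintegral_indicator (hs i), withDensity_apply _ (hs i)]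

/-! ### Radial integrals on `ℂ` -/

/-- Polar coordinates with `t = r ^ 2`: since `r dr = dt / 2`, the angular factor `2π` becomes `π`.
-/
lemma lintegral_radial (F : ℝ → ℝ≥0∞) (hF : Measurable F) :
    ∫⁻ z : ℂ, F (‖z‖ ^ 2) = ENNReal.ofReal Real.pi * ∫⁻ t in Set.Ioi (0 : ℝ), F t := by
  rw [← Complex.lintegral_comp_polarCoord_symm, polarCoord_target]
  have h1 : ∀ p : ℝ × ℝ, ENNReal.ofReal p.1 • F (‖Complex.polarCoord.symm p‖ ^ 2) =
      (ENNReal.ofReal p.1 * F (p.1 ^ 2)) * (fun _ : ℝ => (1 : ℝ≥0∞)) p.2 := by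
    intro p
    simp
  simp_rw [h1]
  rw [Measure.volume_eq_prod, ← Measure.prod_restrict,
    lintegral_prod_mul (f := fun r : ℝ => ENNReal.ofReal r * F (r ^ 2)) (g := fun _ : ℝ => 1)
      (by fun_prop) (by fun_prop)]
  have h2 : (fun r : ℝ => r ^ 2) '' Set.Ioi 0 = Set.Ioi 0 := by
    ext t
    constructor
    · rintro ⟨r, hr, rfl⟩
      exact pow_pos (Set.mem_Ioi.1 hr) 2
    · intro ht
      exact ⟨Real.sqrt t, Real.sqrt_pos.2 ht, Real.sq_sqrt (le_of_lt ht)⟩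
  have h3 := lintegral_image_eq_lintegral_abs_deriv_mul (f := fun r : ℝ => r ^ 2)
    (f' := fun r => 2 * r) measurableSet_Ioi (s := Set.Ioi 0)
    (fun x _ => by simpa using (hasDerivAt_pow 2 x).hasDerivWithinAt)
    (fun a ha b hb hab => by
      exact (pow_left_inj₀ (le_of_lt ha) (le_of_lt hb) two_ne_zero).1 hab) F
  rw [h2] at h3
  rw [h3]
  have h4 : ∀ r ∈ Set.Ioi (0 : ℝ), ENNReal.ofReal |2 * r| * F (r ^ 2) =
      2 * (ENNReal.ofReal r * F (r ^ 2)) := by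
    intro r hr
    rw [abs_of_pos (by have := Set.mem_Ioi.1 hr; positivity),
      ENNReal.ofReal_mul (by norm_num), mul_assoc]
    simp
  rw [setLIntegral_congr_fun measurableSet_Ioi h4, lintegral_const_mul _ (by fun_prop)]
  simp only [lintegral_const, one_mul, Measure.restrict_apply MeasurableSet.univ, Set.univ_inter,
    Real.volume_Ioo]
  rw [show Real.pi - -Real.pi = 2 * Real.pi by ring, ENNReal.ofReal_mul (by norm_num)]
  simp only [ENNReal.ofReal_ofNat]
  ring

lemma lintegral_exp_neg_mul_Ioi {b : ℝ} (hb : 0 < b) :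
    ∫⁻ t in Set.Ioi (0 : ℝ), ENNReal.ofReal (Real.exp (-(b * t))) = ENNReal.ofReal b⁻¹ := by
  rw [← ofReal_integral_eq_lintegral_ofReal]
  · congr 1
    have := integral_exp_mul_Ioi (a := -b) (by linarith) 0
    simp only [neg_mul] at this
    rw [this]
    simp
  · have := integrableOn_exp_mul_Ioi (a := -b) (by linarith) 0
    simp only [neg_mul] at this
    exact this
  · exact Filter.Eventually.of_forall fun t => (Real.exp_pos _).le

lemma lintegral_exp_neg_mul_norm_sq {b : ℝ} (hb : 0 < b) (t₀ : ℂ) :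
    ∫⁻ t : ℂ, ENNReal.ofReal (Real.exp (-(b * ‖t - t₀‖ ^ 2))) = ENNReal.ofReal (Real.pi / b) := by
  rw [lintegral_sub_right_eq_self (fun t : ℂ => ENNReal.ofReal (Real.exp (-(b * ‖t‖ ^ 2)))) t₀,
    lintegral_radial (fun t => ENNReal.ofReal (Real.exp (-(b * t)))) (by fun_prop),
    lintegral_exp_neg_mul_Ioi hb, ← ENNReal.ofReal_mul Real.pi_pos.le, div_eq_mul_inv]

/-! ### Complex Gaussian laws: scaling and densities -/

lemma cgauss_eq_map (m : ℂ) {v : ℝ} (hv : 0 ≤ v) :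
    cgauss m v = (cgauss 0 1).map fun z => m + (Real.sqrt v : ℂ) * z := by
  unfold cgauss
  rw [Measure.map_map (by fun_prop) (by fun_prop)]
  have h : ∀ a : ℝ, gaussianReal a (v / 2).toNNReal =
      (gaussianReal 0 (1 / 2 : ℝ).toNNReal).map fun x => a + Real.sqrt v * x := by
    intro a
    have h1 : (fun x => a + Real.sqrt v * x) = (fun x => a + x) ∘ fun x => Real.sqrt v * x := rfl
    rw [h1, ← Measure.map_map (by fun_prop) (by fun_prop), gaussianReal_map_const_mul,
      gaussianReal_map_const_add]
    congr 1
    · simp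
    · ext
      push_cast
      rw [Real.coe_toNNReal _ (by positivity), Real.coe_toNNReal _ (by positivity)]
      simp only [Real.sq_sqrt hv]
      ring
  rw [h, h, Measure.map_prod_map _ _ (by fun_prop) (by fun_prop),
    Measure.map_map (by fun_prop) (by fun_prop)]
  simp only [Complex.zero_re, Complex.zero_im]
  congr 1
  funext p
  apply Complex.ext <;> simp [Complex.measurableEquivRealProd]

lemma cgauss_eq_withDensity (m : ℂ) {v : ℝ} (hv : 0 < v) :
    cgauss m v = volume.withDensity fun z =>
      ENNReal.ofReal (Real.exp (-(‖z - m‖ ^ 2 / v)) / (Real.pi * v)) := by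
  unfold cgauss
  have hv' : (v / 2).toNNReal ≠ 0 := by
    rw [Ne, Real.toNNReal_eq_zero]; linarith
  rw [gaussianReal_of_var_ne_zero _ hv', gaussianReal_of_var_ne_zero _ hv',
    prod_withDensity (measurable_gaussianPDF _ _) (measurable_gaussianPDF _ _)]
  ext s hs
  rw [Measure.map_apply (by fun_prop) hs, withDensity_apply _ hs,
    withDensity_apply _ (Complex.measurableEquivRealProd.symm.measurable hs),
    ← Measure.volume_eq_prod]
  rw [← (Complex.volume_preserving_equiv_real_prod.symm).setLIntegral_comp_preimage_emb
    Complex.measurableEquivRealProd.symm.measurableEmbedding]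
  refine lintegral_congr fun p => ?_
  unfold gaussianPDF gaussianPDFReal
  rw [← ENNReal.ofReal_mul (by positivity), Real.coe_toNNReal _ (by positivity)]
  congr 1
  have h1 : ‖Complex.measurableEquivRealProd.symm p - m‖ ^ 2
      = (p.1 - m.re) ^ 2 + (p.2 - m.im) ^ 2 := by
    rw [← Complex.normSq_eq_norm_sq, Complex.normSq_apply]
    simp [Complex.measurableEquivRealProd]
    ring
  rw [h1, show -(((p.1 - m.re) ^ 2 + (p.2 - m.im) ^ 2) / v) =
    -(p.1 - m.re) ^ 2 / (2 * (v / 2)) + -(p.2 - m.im) ^ 2 / (2 * (v / 2)) by field_simp; ring,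
    Real.exp_add]
  have h2 : (Real.sqrt (2 * Real.pi * (v / 2)))⁻¹ * (Real.sqrt (2 * Real.pi * (v / 2)))⁻¹
      = (Real.pi * v)⁻¹ := by
    rw [← mul_inv, Real.mul_self_sqrt (by positivity)]
    congr 1
    ring
  rw [div_eq_mul_inv _ (Real.pi * v), ← h2]
  ring

/-- The density of the law `CN(0, I_n)`. -/
def noisePdf {n : ℕ} (y : Fin n → ℂ) : ℝ≥0∞ :=
  ENNReal.ofReal (Real.exp (-normSq y) / Real.pi ^ n)

@[fun_prop]
lemma continuous_normSq {n : ℕ} : Continuous (normSq : (Fin n → ℂ) → ℝ) := by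
  unfold normSq; fun_prop

@[fun_prop]
lemma measurable_normSq {n : ℕ} : Measurable (normSq : (Fin n → ℂ) → ℝ) :=
  continuous_normSq.measurable

lemma measurable_noisePdf {n : ℕ} : Measurable (noisePdf : (Fin n → ℂ) → ℝ≥0∞) := by
  unfold noisePdf; fun_prop

lemma noiseLaw_eq_withDensity (n : ℕ) : noiseLaw n = volume.withDensity noisePdf := by
  unfold noiseLaw
  have h := cgauss_eq_withDensity 0 one_pos
  have : SigmaFinite ((volume : Measure ℂ).withDensity fun z =>
      ENNReal.ofReal (Real.exp (-(‖z - 0‖ ^ 2 / 1)) / (Real.pi * 1))) := by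
    rw [← h]; infer_instance
  rw [h, pi_withDensity_eq _ _ (by fun_prop), ← volume_pi]
  congr 1
  ext y
  unfold noisePdf normSq
  rw [← ENNReal.ofReal_prod_of_nonneg fun i _ => by positivity]
  congr 1
  simp [Finset.prod_div_distrib, ← Real.exp_sum]

lemma lintegral_noiseLaw {n : ℕ} {f : (Fin n → ℂ) → ℝ≥0∞} (hf : Measurable f) :
    ∫⁻ w, f w ∂(noiseLaw n) = ∫⁻ w, noisePdf w * f w := by
  rw [noiseLaw_eq_withDensity, lintegral_withDensity_eq_lintegral_mul _ measurable_noisePdf hf]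
  rfl

/-- The squared modulus is exponential with mean one, so its moments are values of the Gamma
function. -/
lemma lintegral_cgauss_norm_pow (k : ℕ) :
    ∫⁻ z, ENNReal.ofReal (‖z‖ ^ 2) ^ k ∂(cgauss 0 1) = k.factorial := by
  rw [cgauss_eq_withDensity 0 one_pos, lintegral_withDensity_eq_lintegral_mul _ (by fun_prop)
    (by fun_prop)]
  simp only [Pi.mul_apply, sub_zero, div_one, mul_one]
  rw [lintegral_radial (fun t => ENNReal.ofReal (Real.exp (-t) / Real.pi) * ENNReal.ofReal t ^ k)
    (by fun_prop)]
  have h : ∀ t ∈ Set.Ioi (0 : ℝ), ENNReal.ofReal (Real.exp (-t) / Real.pi) * ENNReal.ofReal t ^ k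
      = ENNReal.ofReal Real.pi⁻¹ *
        ENNReal.ofReal (Real.exp (-t) * t ^ ((k + 1 : ℝ) - 1)) := by
    intro t ht
    rw [← ENNReal.ofReal_pow (le_of_lt ht), ← ENNReal.ofReal_mul (by positivity),
      ← ENNReal.ofReal_mul (by positivity)]
    congr 1
    rw [add_sub_cancel_right, Real.rpow_natCast]
    ring
  rw [setLIntegral_congr_fun measurableSet_Ioi h, lintegral_const_mul _ (by fun_prop), ← mul_assoc,
    ← ENNReal.ofReal_mul Real.pi_pos.le, mul_inv_cancel₀ Real.pi_ne_zero,
    ← ofReal_integral_eq_lintegral_ofReal]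
  · rw [← Real.Gamma_eq_integral (by positivity), Real.Gamma_nat_eq_factorial]
    simp
  · exact Real.GammaIntegral_convergent (by positivity)
  · refine (ae_restrict_mem measurableSet_Ioi).mono fun t ht => ?_
    have : 0 < t := ht
    positivity

/-! ### Unitary maps of `ℂⁿ` -/

/-- The linear map `L` preserves the standard Hermitian form of `ℂⁿ`. -/
def IsUnitaryMap {n : ℕ} (L : (Fin n → ℂ) →ₗ[ℂ] (Fin n → ℂ)) : Prop :=
  ∀ x y, star (L x) ⬝ᵥ L y = star x ⬝ᵥ y

lemma ofReal_normSq {n : ℕ} (x : Fin n → ℂ) : (normSq x : ℂ) = star x ⬝ᵥ x := by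
  simp only [normSq, dotProduct, Pi.star_apply, RCLike.star_def, Complex.ofReal_sum,
    Complex.conj_mul', Complex.ofReal_pow]

lemma normSq_nonneg {n : ℕ} (x : Fin n → ℂ) : 0 ≤ normSq x :=
  Finset.sum_nonneg fun _ _ => by positivity

lemma normSq_eq_zero {n : ℕ} {x : Fin n → ℂ} : normSq x = 0 ↔ x = 0 := by
  unfold normSq
  rw [Finset.sum_eq_zero_iff_of_nonneg fun _ _ => by positivity]
  simp [funext_iff]

lemma normSq_smul {n : ℕ} (c : ℂ) (x : Fin n → ℂ) : normSq (c • x) = ‖c‖ ^ 2 * normSq x := by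
  simp [normSq, mul_pow, Finset.mul_sum]

lemma normSq_single {n : ℕ} (i : Fin n) (c : ℂ) : normSq (Pi.single i c) = ‖c‖ ^ 2 := by
  unfold normSq
  rw [Finset.sum_eq_single i]
  · simp
  · intro j _ hj
    simp [Pi.single_eq_of_ne hj]
  · simp

namespace IsUnitaryMap

variable {n : ℕ} {L : (Fin n → ℂ) →ₗ[ℂ] (Fin n → ℂ)}

lemma normSq_apply (hL : IsUnitaryMap L) (x : Fin n → ℂ) : normSq (L x) = normSq x := by
  have := hL x x
  rw [← ofReal_normSq, ← ofReal_normSq] at this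
  exact_mod_cast this

lemma injective (hL : IsUnitaryMap L) : Function.Injective L := by
  rw [injective_iff_map_eq_zero]
  intro x hx
  rw [← normSq_eq_zero, ← hL.normSq_apply, hx, normSq_eq_zero]

lemma measurable (L : (Fin n → ℂ) →ₗ[ℂ] (Fin n → ℂ)) : Measurable L :=
  L.continuous_of_finiteDimensional.measurable

/-- The determinant need not be computed: `L` scales Lebesgue measure by some constant and preserves
the density, and comparing total masses forces the constant to be one. -/
lemma map_noiseLaw (hL : IsUnitaryMap L) : (noiseLaw n).map L = noiseLaw n := by
  have hdet : LinearMap.det (L.restrictScalars ℝ) ≠ 0 := by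
    have hb : Function.Bijective (L.restrictScalars ℝ) :=
      ⟨hL.injective, (LinearMap.injective_iff_surjective (f := L)).1 hL.injective⟩
    exact (LinearEquiv.isUnit_det' (LinearEquiv.ofBijective _ hb)).ne_zero
  have hv := Measure.map_linearMap_addHaar_eq_smul_addHaar
    (volume : Measure (Fin n → ℂ)) hdet
  set c := ENNReal.ofReal |(LinearMap.det (L.restrictScalars ℝ))⁻¹|
  have hm : Measurable (L.restrictScalars ℝ) := measurable L
  have key : (noiseLaw n).map L = c • noiseLaw n := by
    ext s hs
    rw [Measure.map_apply (measurable L) hs, Measure.smul_apply, noiseLaw_eq_withDensity,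
      withDensity_apply _ (measurable L hs), withDensity_apply _ hs, smul_eq_mul]
    have h1 : ∫⁻ x in L ⁻¹' s, noisePdf x =
        ∫⁻ x in L ⁻¹' s, noisePdf (L.restrictScalars ℝ x) := lintegral_congr fun x => by
      simp [noisePdf, hL.normSq_apply]
    rw [h1]
    have h2 := setLIntegral_map (μ := (volume : Measure (Fin n → ℂ))) hs measurable_noisePdf hm
    rw [hv] at h2
    rw [Measure.restrict_smul, lintegral_smul_measure] at h2
    exact h2.symm
  have hc : c = 1 := by
    have h := congrArg (fun μ => μ Set.univ) key
    simp only [Measure.map_apply (measurable L) MeasurableSet.univ, Set.preimage_univ,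
      measure_univ, Measure.smul_apply, smul_eq_mul, mul_one] at h
    exact h.symm
  rw [key, hc, one_smul]

end IsUnitaryMap

/-- The isometry between the complex lines spanned by the two vectors extends to the whole space. -/
lemma exists_isUnitaryMap_apply_eq {n : ℕ} {x y : Fin n → ℂ} (h : normSq x = normSq y) :
    ∃ L : (Fin n → ℂ) →ₗ[ℂ] (Fin n → ℂ), IsUnitaryMap L ∧ L x = y := by
  let E := EuclideanSpace ℂ (Fin n)
  let e : E ≃ₗ[ℂ] (Fin n → ℂ) := WithLp.linearEquiv 2 ℂ (Fin n → ℂ)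
  have hin : ∀ a b : E, inner ℂ a b = star (e a) ⬝ᵥ e b := fun a b => by
    rw [EuclideanSpace.inner_eq_star_dotProduct, dotProduct_comm]
    rfl
  have hnorm : ∀ a : Fin n → ℂ, ‖e.symm a‖ ^ 2 = normSq a := fun a => by
    rw [EuclideanSpace.norm_sq_eq]
    rfl
  suffices H : ∃ T : E →ₗᵢ[ℂ] E, T (e.symm x) = e.symm y by
    obtain ⟨T, hT⟩ := H
    refine ⟨e.toLinearMap ∘ₗ T.toLinearMap ∘ₗ e.symm.toLinearMap, fun a b => ?_, ?_⟩
    · have := T.inner_map_map (e.symm a) (e.symm b)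
      rw [hin, hin] at this
      simpa using this
    · simp [hT]
  by_cases hx : x = 0
  · have hy : y = 0 := by
      rw [← normSq_eq_zero, ← h, hx, normSq_eq_zero]
    exact ⟨LinearIsometry.id, by simp [hx, hy]⟩
  have hxpos : 0 < ‖e.symm x‖ := by
    rw [norm_pos_iff]
    simpa using hx
  have hxy : ‖e.symm y‖ = ‖e.symm x‖ := by
    rw [← pow_left_inj₀ (norm_nonneg _) (norm_nonneg _) two_ne_zero, hnorm, hnorm, h]
  set r : ℂ := ((‖e.symm x‖ : ℝ) : ℂ)
  have hr : r ≠ 0 := by simpa [r] using hxpos.ne'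
  have hu : ‖r⁻¹ • e.symm x‖ = 1 := by
    rw [norm_smul, norm_inv, Complex.norm_real, norm_norm, inv_mul_cancel₀ hxpos.ne']
  have hw : ‖r⁻¹ • e.symm y‖ = 1 := by
    rw [norm_smul, norm_inv, hxy, Complex.norm_real, norm_norm, inv_mul_cancel₀ hxpos.ne']
  let A := LinearIsometryEquiv.toSpanUnitSingleton (𝕜 := ℂ) _ hu
  let B := LinearIsometryEquiv.toSpanUnitSingleton (𝕜 := ℂ) _ hw
  let S : _ →ₗᵢ[ℂ] E := (Submodule.subtypeₗᵢ _).comp (B.toLinearIsometry.comp A.symm.toLinearIsometry)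
  refine ⟨S.extend, ?_⟩
  have h1 : e.symm x = ((A r : _) : E) := by
    simp [A, smul_smul, hr]
  have h2 : S (A r) = e.symm y := by simp [S, B, smul_smul, hr]
  rw [← h2, ← LinearIsometry.extend_apply S (A r), ← h1]

lemma noiseLaw_map_eval {n : ℕ} (i : Fin n) : (noiseLaw n).map (fun w => w i) = cgauss 0 1 :=
  (measurePreserving_eval (fun _ : Fin n => cgauss 0 1) i).map_eq

/-- After `x` is rotated onto the first axis, the form is a multiple of one coordinate of the noise.
-/
lemma noiseLaw_map_dotProduct {n : ℕ} [NeZero n] (x : Fin n → ℂ) :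
    (noiseLaw n).map (fun w => star x ⬝ᵥ w) = cgauss 0 (normSq x) := by
  obtain ⟨L, hL, hx⟩ := exists_isUnitaryMap_apply_eq (x := x)
    (y := Pi.single (0 : Fin n) (Real.sqrt (normSq x) : ℂ)) (by
      rw [normSq_single]
      simp [Real.sq_sqrt (normSq_nonneg x)])
  have h : (fun w => star x ⬝ᵥ w) =
      (fun z : ℂ => 0 + (Real.sqrt (normSq x) : ℂ) * z) ∘ (fun w => w 0) ∘ L := by
    funext w
    rw [← hL x w, hx]
    simp [Pi.star_single]
  rw [h, ← Measure.map_map (by fun_prop)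
    ((measurable_pi_apply _).comp (IsUnitaryMap.measurable L)),
    ← Measure.map_map (measurable_pi_apply _) (IsUnitaryMap.measurable L), hL.map_noiseLaw,
    noiseLaw_map_eval, ← cgauss_eq_map 0 (normSq_nonneg x)]

/-! ### The uniform law on the unit sphere of `ℂⁿ` -/

/-- The unit vector in the direction of `g`. -/
def direction {n : ℕ} (g : Fin n → ℂ) : Fin n → ℂ := ((Real.sqrt (normSq g))⁻¹ : ℂ) • g

@[fun_prop]
lemma measurable_direction {n : ℕ} : Measurable (direction : (Fin n → ℂ) → Fin n → ℂ) := by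
  unfold direction
  have h : Measurable fun g : Fin n → ℂ => ((Real.sqrt (normSq g))⁻¹ : ℂ) :=
    (Complex.measurable_ofReal.comp (by fun_prop : Measurable fun g : Fin n → ℂ =>
      Real.sqrt (normSq g))).inv
  exact h.smul measurable_id

/-- The uniform law on the unit sphere of `ℂⁿ`. -/
def sphereLaw (n : ℕ) : Measure (Fin n → ℂ) := (noiseLaw n).map direction

instance (n : ℕ) : IsProbabilityMeasure (sphereLaw n) :=
  Measure.isProbabilityMeasure_map measurable_direction.aemeasurable

lemma ae_normSq_sphereLaw (n : ℕ) [NeZero n] : ∀ᵐ x ∂(sphereLaw n), normSq x = 1 := by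
  unfold sphereLaw
  rw [ae_map_iff measurable_direction.aemeasurable
    (measurableSet_eq_fun (by fun_prop) (by fun_prop))]
  -- `direction 0 = 0` is not a unit vector, so the origin is discarded as a null set.
  have h0 : ∀ᵐ g ∂(noiseLaw n), g ≠ 0 := by
    rw [noiseLaw_eq_withDensity]
    refine (withDensity_absolutelyContinuous _ _).ae_le ?_
    have : Nonempty (Fin n) := ⟨0⟩
    exact compl_mem_ae_iff.2 (measure_singleton _)
  filter_upwards [h0] with g hg
  have hpos : 0 < normSq g := lt_of_le_of_ne (normSq_nonneg g) fun h => hg (normSq_eq_zero.1 h.symm)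
  unfold direction
  rw [normSq_smul, norm_inv, Complex.norm_real, Real.norm_of_nonneg (Real.sqrt_nonneg _), inv_pow,
    Real.sq_sqrt hpos.le, inv_mul_cancel₀ hpos.ne']

lemma IsUnitaryMap.map_sphereLaw {n : ℕ} {L : (Fin n → ℂ) →ₗ[ℂ] (Fin n → ℂ)}
    (hL : IsUnitaryMap L) : (sphereLaw n).map L = sphereLaw n := by
  have h : L ∘ direction = direction ∘ L := by
    funext g
    simp [direction, hL.normSq_apply]
  unfold sphereLaw
  rw [Measure.map_map (IsUnitaryMap.measurable L) measurable_direction, h,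
    ← Measure.map_map measurable_direction (IsUnitaryMap.measurable L), hL.map_noiseLaw]

lemma IsUnitaryMap.lintegral_sphereLaw {n : ℕ} {L : (Fin n → ℂ) →ₗ[ℂ] (Fin n → ℂ)}
    (hL : IsUnitaryMap L) {f : (Fin n → ℂ) → ℝ≥0∞} (hf : Measurable f) :
    ∫⁻ x, f (L x) ∂(sphereLaw n) = ∫⁻ x, f x ∂(sphereLaw n) := by
  conv_rhs => rw [← hL.map_sphereLaw]
  rw [lintegral_map hf (IsUnitaryMap.measurable L)]

/-- In the multinomial expansion the coefficient of each multi-index cancels against its moments `∏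
(a i)!`, leaving `k!`; the binomial coefficient counts the multi-indices. -/
lemma lintegral_noiseLaw_normSq_pow (n k : ℕ) [NeZero n] :
    ∫⁻ g, ENNReal.ofReal (normSq g) ^ k ∂(noiseLaw n) =
      k.factorial * ((n + k - 1).choose k : ℕ) := by
  have h : ∀ g : Fin n → ℂ, ENNReal.ofReal (normSq g) ^ k =
      ∑ a ∈ Finset.piAntidiag Finset.univ k,
        (Nat.multinomial Finset.univ a : ℝ≥0∞) * ∏ i, ENNReal.ofReal (‖g i‖ ^ 2) ^ a i := by
    intro g
    unfold normSq
    rw [ENNReal.ofReal_sum_of_nonneg fun _ _ => by positivity, Finset.sum_pow_eq_sum_piAntidiag]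
  simp_rw [h]
  rw [lintegral_finsetSum _ fun a _ => by fun_prop]
  have h2 : ∀ a ∈ Finset.piAntidiag (Finset.univ : Finset (Fin n)) k,
      ∫⁻ g, (Nat.multinomial Finset.univ a : ℝ≥0∞) * ∏ i, ENNReal.ofReal (‖g i‖ ^ 2) ^ a i
        ∂(noiseLaw n) = k.factorial := by
    intro a ha
    rw [lintegral_const_mul _ (by fun_prop)]
    unfold noiseLaw
    rw [lintegral_pi_prod n _ (fun i z => ENNReal.ofReal (‖z‖ ^ 2) ^ a i) (fun i => by fun_prop)]
    simp_rw [lintegral_cgauss_norm_pow]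
    rw [Finset.mem_piAntidiag] at ha
    rw [← ha.1, ← Nat.multinomial_spec, mul_comm]
    push_cast
    rfl
  rw [Finset.sum_congr rfl h2, Finset.sum_const, nsmul_eq_mul, mul_comm]
  congr 2
  have h3 := Finset.card_finsuppAntidiag_nat_eq_choose (s := (Finset.univ : Finset (Fin n))) k
  rw [Finset.card_univ, Fintype.card_fin] at h3
  rw [← h3]
  simp [Finset.finsuppAntidiag]

/-! ### Moments and exponential moments of the uniform law on the sphere -/

lemma exists_isUnitaryMap_dotProduct {n : ℕ} [NeZero n] (y : Fin n → ℂ) :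
    ∃ L : (Fin n → ℂ) →ₗ[ℂ] (Fin n → ℂ), IsUnitaryMap L ∧
      ∀ x, star y ⬝ᵥ x = (Real.sqrt (normSq y) : ℂ) * L x 0 := by
  obtain ⟨L, hL, hy⟩ := exists_isUnitaryMap_apply_eq (x := y)
    (y := Pi.single (0 : Fin n) (Real.sqrt (normSq y) : ℂ)) (by
      rw [normSq_single]
      simp [Real.sq_sqrt (normSq_nonneg y)])
  refine ⟨L, hL, fun x => ?_⟩
  rw [← hL y x, hy]
  simp [Pi.star_single]

lemma norm_star_dotProduct_comm {n : ℕ} (x y : Fin n → ℂ) :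
    ‖star x ⬝ᵥ y‖ = ‖star y ⬝ᵥ x‖ := by
  rw [Matrix.star_dotProduct, norm_star]

@[fun_prop]
lemma continuous_star_dotProduct {n : ℕ} :
    Continuous fun p : (Fin n → ℂ) × (Fin n → ℂ) => star p.1 ⬝ᵥ p.2 := by
  unfold dotProduct
  simp only [Pi.star_apply]
  fun_prop

lemma lintegral_sphereLaw_dotProduct_pow {n : ℕ} [NeZero n] (y : Fin n → ℂ) (k : ℕ) :
    ∫⁻ x, ENNReal.ofReal (‖star y ⬝ᵥ x‖ ^ 2) ^ k ∂(sphereLaw n) =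
      ENNReal.ofReal (normSq y) ^ k * ∫⁻ x, ENNReal.ofReal (‖x 0‖ ^ 2) ^ k ∂(sphereLaw n) := by
  obtain ⟨L, hL, h⟩ := exists_isUnitaryMap_dotProduct y
  have h1 : ∀ x, ENNReal.ofReal (‖star y ⬝ᵥ x‖ ^ 2) ^ k =
      ENNReal.ofReal (normSq y) ^ k * ENNReal.ofReal (‖L x 0‖ ^ 2) ^ k := by
    intro x
    rw [h, ← mul_pow, ← ENNReal.ofReal_mul (normSq_nonneg y), norm_mul, mul_pow,
      Complex.norm_real, Real.norm_of_nonneg (Real.sqrt_nonneg _), Real.sq_sqrt (normSq_nonneg y)]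
  simp_rw [h1]
  rw [lintegral_const_mul]
  · rw [hL.lintegral_sphereLaw (f := fun x => ENNReal.ofReal (‖x 0‖ ^ 2) ^ k) (by fun_prop)]
  · have := IsUnitaryMap.measurable L
    fun_prop

/-- The moment of `star x ⬝ᵥ g`, for `x` uniform on the sphere and `g` Gaussian, is computed in both
orders. With `x` fixed the product is a standard Gaussian; with `g` fixed the unknown sphere moment
appears times a power of `normSq g`. -/
lemma choose_mul_lintegral_sphereLaw_pow (n k : ℕ) [NeZero n] :
    ((n + k - 1).choose k : ℕ) * ∫⁻ x, ENNReal.ofReal (‖x 0‖ ^ 2) ^ k ∂(sphereLaw n) = 1 := by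
  have hm : Measurable fun p : (Fin n → ℂ) × (Fin n → ℂ) =>
      ENNReal.ofReal (‖star p.1 ⬝ᵥ p.2‖ ^ 2) ^ k := by fun_prop
  have h1 : ∫⁻ x, ∫⁻ g, ENNReal.ofReal (‖star x ⬝ᵥ g‖ ^ 2) ^ k ∂(noiseLaw n) ∂(sphereLaw n)
      = k.factorial := by
    have h : ∀ᵐ x ∂(sphereLaw n), ∫⁻ g, ENNReal.ofReal (‖star x ⬝ᵥ g‖ ^ 2) ^ k ∂(noiseLaw n)
        = k.factorial := by
      filter_upwards [ae_normSq_sphereLaw n] with x hx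
      rw [← lintegral_map (f := fun z => ENNReal.ofReal (‖z‖ ^ 2) ^ k) (by fun_prop)
        (by fun_prop : Measurable fun g : Fin n → ℂ => star x ⬝ᵥ g),
        noiseLaw_map_dotProduct, hx, lintegral_cgauss_norm_pow]
    rw [lintegral_congr_ae h, lintegral_const, measure_univ, mul_one]
  rw [lintegral_lintegral_swap hm.aemeasurable] at h1
  simp_rw [norm_star_dotProduct_comm _, lintegral_sphereLaw_dotProduct_pow] at h1
  rw [lintegral_mul_const _ (by fun_prop), lintegral_noiseLaw_normSq_pow, mul_assoc] at h1
  have h2 : (k.factorial : ℝ≥0∞) ≠ 0 := by exact_mod_cast k.factorial_ne_zero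
  exact (ENNReal.mul_right_inj h2 (ENNReal.natCast_ne_top _)).1 (by rw [h1, mul_one])

lemma norm_apply_le_one_sphereLaw (n : ℕ) [NeZero n] : ∀ᵐ x ∂(sphereLaw n), ‖x 0‖ ≤ 1 := by
  filter_upwards [ae_normSq_sphereLaw n] with x hx
  have h : ‖x 0‖ ^ 2 ≤ 1 := by
    rw [← hx]
    exact Finset.single_le_sum (f := fun i => ‖x i‖ ^ 2) (fun _ _ => by positivity)
      (Finset.mem_univ 0)
  exact (sq_le_one_iff₀ (norm_nonneg _)).1 h

lemma integral_sphereLaw_pow (n k : ℕ) [NeZero n] :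
    ∫ x, (‖x 0‖ ^ 2) ^ k ∂(sphereLaw n) = (((n + k - 1).choose k : ℕ) : ℝ)⁻¹ := by
  rw [integral_eq_lintegral_of_nonneg_ae (Filter.Eventually.of_forall fun x => by positivity)
    (by fun_prop : Measurable fun x : Fin n → ℂ => (‖x 0‖ ^ 2) ^ k).aestronglyMeasurable]
  have h := choose_mul_lintegral_sphereLaw_pow n k
  simp_rw [← ENNReal.ofReal_pow (sq_nonneg _)] at h
  have h2 := congrArg ENNReal.toReal h
  rw [ENNReal.toReal_mul, ENNReal.toReal_natCast, ENNReal.toReal_one] at h2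
  exact eq_inv_of_mul_eq_one_right h2

/-- The entire function `u ↦ ∑ k, u ^ (2 k) / (k! (k + ν)!)`, that is, `I_ν(2 u) / u ^ ν`. -/
def besselSeries (ν : ℕ) (u : ℝ) : ℝ :=
  ∑' k : ℕ, u ^ (2 * k) / ((k.factorial : ℝ) * ((k + ν).factorial : ℝ))

lemma integral_sphereLaw_mixed_pow {n : ℕ} [NeZero n] {j k : ℕ} (hjk : j ≠ k) :
    ∫ x, (x 0) ^ j * (starRingEnd ℂ (x 0)) ^ k ∂(sphereLaw n) = 0 := by
  -- With this phase, rotating the coordinate multiplies the integrand by `c ^ (j - k) = -1`, so the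
  -- integral equals its negative.
  set θ : ℝ := Real.pi / ((j : ℝ) - k)
  have hd : ((j : ℝ) - k) ≠ 0 := sub_ne_zero.2 (by exact_mod_cast hjk)
  set c : ℂ := Complex.exp (θ * Complex.I)
  have hc : starRingEnd ℂ c * c = 1 := by
    rw [Complex.conj_mul', Complex.norm_exp_ofReal_mul_I]
    norm_num
  let L : (Fin n → ℂ) →ₗ[ℂ] (Fin n → ℂ) := c • LinearMap.id
  have hL : IsUnitaryMap L := fun x y => by
    simp only [L, LinearMap.smul_apply, LinearMap.id_apply, star_smul, smul_dotProduct,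
      dotProduct_smul, smul_eq_mul, RCLike.star_def]
    linear_combination (star x ⬝ᵥ y) * hc
  have hcc : c ^ j * (starRingEnd ℂ c) ^ k = -1 := by
    simp only [c, ← Complex.exp_conj, ← Complex.exp_nat_mul, ← Complex.exp_add]
    rw [map_mul, Complex.conj_ofReal, Complex.conj_I, ← Complex.exp_pi_mul_I]
    congr 1
    have : (Real.pi : ℂ) = θ * ((j : ℂ) - k) := by
      simp only [θ]
      have : ((j : ℂ) - k) ≠ 0 := by exact_mod_cast hd
      push_cast
      field_simp
    rw [this]
    ring
  have h1 : ∫ x, (x 0) ^ j * (starRingEnd ℂ (x 0)) ^ k ∂(sphereLaw n) =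
      ∫ x, (L x 0) ^ j * (starRingEnd ℂ (L x 0)) ^ k ∂(sphereLaw n) := by
    conv_lhs => rw [← hL.map_sphereLaw]
    rw [integral_map (IsUnitaryMap.measurable L).aemeasurable]
    exact (by fun_prop : Measurable fun x : Fin n → ℂ =>
      (x 0) ^ j * (starRingEnd ℂ (x 0)) ^ k).aestronglyMeasurable
  have h2 : ∀ x : Fin n → ℂ, (L x 0) ^ j * (starRingEnd ℂ (L x 0)) ^ k =
      -((x 0) ^ j * (starRingEnd ℂ (x 0)) ^ k) := by
    intro x
    simp only [L, LinearMap.smul_apply, LinearMap.id_apply, Pi.smul_apply, smul_eq_mul, map_mul,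
      mul_pow]
    linear_combination ((x 0) ^ j * (starRingEnd ℂ (x 0)) ^ k) * hcc
  simp_rw [h2] at h1
  rw [integral_neg] at h1
  exact self_eq_neg.1 h1

/-- The exponential is `exp (r x₀) * exp (r conj x₀)`. Its double power series may be integrated
termwise because the coordinate is bounded by one, and phase invariance kills the off-diagonal
terms. -/
lemma hasSum_integral_sphereLaw_exp (n : ℕ) [NeZero n] {r : ℝ} (hr : 0 ≤ r) :
    HasSum (fun k : ℕ => r ^ (2 * k) / ((k.factorial : ℝ) * (k.factorial : ℝ)) *
      (((n + k - 1).choose k : ℕ) : ℝ)⁻¹)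
      (∫ x, Real.exp (2 * (r * (x 0).re)) ∂(sphereLaw n)) := by
  let F : ℕ × ℕ → (Fin n → ℂ) → ℂ := fun p x =>
    ((r : ℂ) * x 0) ^ p.1 / (p.1.factorial : ℂ) *
      (((r : ℂ) * starRingEnd ℂ (x 0)) ^ p.2 / (p.2.factorial : ℂ))
  have hbound : ∀ p, ∀ᵐ x ∂(sphereLaw n), ‖F p x‖ ≤
      r ^ p.1 / (p.1.factorial : ℝ) * (r ^ p.2 / (p.2.factorial : ℝ)) := by
    intro p
    filter_upwards [norm_apply_le_one_sphereLaw n] with x hx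
    have h : r * ‖x 0‖ ≤ r := mul_le_of_le_one_right hr hx
    simp only [F, norm_mul, norm_div, norm_pow, Complex.norm_real, RCLike.norm_conj,
      Real.norm_of_nonneg hr, Complex.norm_natCast]
    gcongr
  have hint : ∀ p, Integrable (F p) (sphereLaw n) := fun p =>
    Integrable.of_bound (by fun_prop : Measurable (F p)).aestronglyMeasurable _ (hbound p)
  have hsum : Summable fun p => ∫ x, ‖F p x‖ ∂(sphereLaw n) := by
    refine Summable.of_nonneg_of_le (fun p => integral_nonneg fun x => norm_nonneg _)
      (fun p => ?_) ((Real.summable_pow_div_factorial r).mul_of_nonneg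
        (Real.summable_pow_div_factorial r) (fun k => by positivity) (fun k => by positivity))
    calc ∫ x, ‖F p x‖ ∂(sphereLaw n)
        ≤ ∫ x, r ^ p.1 / (p.1.factorial : ℝ) * (r ^ p.2 / (p.2.factorial : ℝ)) ∂(sphereLaw n) :=
          integral_mono_ae (hint p).norm (integrable_const _) (hbound p)
      _ = _ := by simp
  have h := hasSum_integral_of_summable_integral_norm hint hsum
  have htsum : ∀ x, ∑' p, F p x = ((Real.exp (2 * (r * (x 0).re)) : ℝ) : ℂ) := by
    intro x
    have h1 := NormedSpace.expSeries_div_summable (𝔸 := ℂ) ((r : ℂ) * x 0)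
    have h2 := NormedSpace.expSeries_div_summable (𝔸 := ℂ) ((r : ℂ) * starRingEnd ℂ (x 0))
    have h1' := NormedSpace.norm_expSeries_div_summable (𝔸 := ℂ) ((r : ℂ) * x 0)
    have h2' := NormedSpace.norm_expSeries_div_summable (𝔸 := ℂ) ((r : ℂ) * starRingEnd ℂ (x 0))
    have h3 := tsum_mul_tsum_of_summable_norm h1' h2'
    simp only [F]
    rw [← h3, ← congrFun (NormedSpace.exp_eq_tsum_div (𝔸 := ℂ)) _,
      ← congrFun (NormedSpace.exp_eq_tsum_div (𝔸 := ℂ)) _, ← Complex.exp_eq_exp_ℂ,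
      ← Complex.exp_add, ← mul_add, Complex.add_conj, ← Complex.ofReal_mul, Complex.ofReal_exp]
    congr 2
    ring
  simp_rw [htsum] at h
  rw [integral_complex_ofReal] at h
  have hF : ∀ p, ∫ x, F p x ∂(sphereLaw n) = ((r : ℂ) ^ p.1 / p.1.factorial *
      ((r : ℂ) ^ p.2 / p.2.factorial)) *
        ∫ x, (x 0) ^ p.1 * (starRingEnd ℂ (x 0)) ^ p.2 ∂(sphereLaw n) := by
    intro p
    rw [← integral_const_mul]
    refine integral_congr_ae (Filter.Eventually.of_forall fun x => ?_)
    simp only [F]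
    ring
  have hinj : Function.Injective fun k : ℕ => ((k, k) : ℕ × ℕ) := fun a b hab =>
    (Prod.mk.inj hab).1
  rw [← hinj.hasSum_iff] at h
  · refine Complex.hasSum_ofReal.1 ?_
    refine Eq.mp (congrArg (fun f => HasSum f _) (funext fun k => ?_)) h
    simp only [Function.comp, hF]
    have h4 : ∀ x : Fin n → ℂ, (x 0) ^ k * (starRingEnd ℂ (x 0)) ^ k =
        (((‖x 0‖ ^ 2) ^ k : ℝ) : ℂ) := by
      intro x
      rw [← mul_pow, Complex.mul_conj']
      push_cast
      rfl
    simp_rw [h4]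
    rw [integral_complex_ofReal, integral_sphereLaw_pow]
    push_cast
    ring
  · rintro ⟨j, k⟩ hp
    rw [hF, integral_sphereLaw_mixed_pow, mul_zero]
    exact fun hh => hp ⟨j, Prod.ext rfl hh⟩

lemma integral_sphereLaw_exp (n : ℕ) [NeZero n] {r : ℝ} (hr : 0 ≤ r) :
    ∫ x, Real.exp (2 * (r * (x 0).re)) ∂(sphereLaw n) =
      ((n - 1).factorial : ℝ) * besselSeries (n - 1) r := by
  rw [← (hasSum_integral_sphereLaw_exp n hr).tsum_eq, besselSeries, ← tsum_mul_left]
  refine tsum_congr fun k => ?_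
  have hn : 0 < n := Nat.pos_of_neZero n
  have h1 : n + k - 1 = k + (n - 1) := by omega
  have h2 := Nat.add_choose_mul_factorial_mul_factorial k (n - 1)
  rw [← Nat.choose_symm_add] at h2
  rw [h1]
  have h3 : (((k + (n - 1)).choose k : ℕ) : ℝ) * k.factorial * (n - 1).factorial =
      (k + (n - 1)).factorial := by
    exact_mod_cast h2
  have h4 : (((k + (n - 1)).choose k : ℕ) : ℝ) ≠ 0 := by
    exact_mod_cast (Nat.choose_pos (Nat.le_add_right k _)).ne'
  rw [← h3]
  have h5 : ((n - 1).factorial : ℝ) ≠ 0 := by exact_mod_cast (n - 1).factorial_ne_zero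
  have h6 : (k.factorial : ℝ) ≠ 0 := by exact_mod_cast k.factorial_ne_zero
  field_simp

/-- The source of both Bessel functions in the bound: `I_{n-1}` from the codeword sphere, and `I_0`
from the case `n = 1`, which averages over a phase. -/
lemma lintegral_sphereLaw_exp {n : ℕ} [NeZero n] (y : Fin n → ℂ) :
    ∫⁻ x, ENNReal.ofReal (Real.exp (2 * (star y ⬝ᵥ x).re)) ∂(sphereLaw n) =
      ENNReal.ofReal (((n - 1).factorial : ℝ) * besselSeries (n - 1) (Real.sqrt (normSq y))) := by
  obtain ⟨L, hL, h⟩ := exists_isUnitaryMap_dotProduct y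
  simp_rw [h, Complex.re_ofReal_mul]
  rw [hL.lintegral_sphereLaw (f := fun x =>
      ENNReal.ofReal (Real.exp (2 * (Real.sqrt (normSq y) * (x 0).re)))) (by fun_prop),
    ← integral_sphereLaw_exp n (Real.sqrt_nonneg _), ofReal_integral_eq_lintegral_ofReal]
  · refine Integrable.of_bound (C := Real.exp (2 * Real.sqrt (normSq y)))
      (by fun_prop : Measurable _).aestronglyMeasurable ?_
    filter_upwards [norm_apply_le_one_sphereLaw n] with x hx
    rw [Real.norm_of_nonneg (Real.exp_pos _).le, Real.exp_le_exp]
    have h1 : (x 0).re ≤ 1 := (Complex.re_le_norm _).trans hx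
    nlinarith [Real.sqrt_nonneg (normSq y)]
  · exact Filter.Eventually.of_forall fun x => (Real.exp_pos _).le

lemma besselSeries_nonneg (ν : ℕ) (u : ℝ) : 0 ≤ besselSeries ν u :=
  tsum_nonneg fun k => by
    rw [pow_mul]
    positivity

lemma besselSeries_abs (ν : ℕ) (u : ℝ) : besselSeries ν |u| = besselSeries ν u := by
  unfold besselSeries
  simp_rw [pow_mul, sq_abs]

@[fun_prop]
-- The sphere integral represents the series as a parameter integral, whose measurability follows
-- from Tonelli's theorem.
lemma measurable_besselSeries (ν : ℕ) : Measurable (besselSeries ν) := by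
  have h : besselSeries ν = fun u : ℝ => (∫⁻ x : Fin (ν + 1) → ℂ, ENNReal.ofReal (Real.exp
      (2 * (star (Pi.single (0 : Fin (ν + 1)) (u : ℂ)) ⬝ᵥ x).re)) ∂(sphereLaw (ν + 1))).toReal /
        (ν.factorial : ℝ) := by
    funext u
    rw [lintegral_sphereLaw_exp, ENNReal.toReal_ofReal (mul_nonneg (by positivity)
      (besselSeries_nonneg _ _)), normSq_single, Complex.norm_real, Real.norm_eq_abs,
      Real.sqrt_sq (abs_nonneg u), besselSeries_abs, Nat.add_sub_cancel,
      mul_div_cancel_left₀ _ (by exact_mod_cast ν.factorial_ne_zero)]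
  rw [h]
  refine (Measurable.ennreal_toReal (Measurable.lintegral_prod_right' (f := fun p : ℝ × _ =>
    ENNReal.ofReal (Real.exp (2 * (star (Pi.single (0 : Fin (ν + 1)) (p.1 : ℂ)) ⬝ᵥ p.2).re)))
      ?_)).div_const _
  simp only [Pi.star_single, single_dotProduct]
  fun_prop

/-- Absorbs the exceptional value at `a = 0`: the power series covers both cases. -/
lemma besselQuot_eq (ν : ℕ) (s a : ℝ) : besselQuot ν s a = s ^ ν * besselSeries ν (s * a) := by
  unfold besselQuot
  split_ifs with ha
  · rw [ha, besselSeries, tsum_eq_single 0]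
    · simp [div_eq_mul_inv]
    · intro k hk
      simp [hk]
  · rw [besselI, besselSeries, ← tsum_mul_left, ← tsum_div_const]
    refine tsum_congr fun k => ?_
    rw [show 2 * s * a / 2 = s * a by ring, pow_add, mul_pow s a ν]
    field_simp

lemma besselI_zero_eq (x : ℝ) : besselI 0 x = besselSeries 0 (x / 2) := by
  simp [besselI, besselSeries]

/-! ### The decoding metric -/

lemma varH_pos {κ : ℝ} (hκ : 0 ≤ κ) : 0 < varH κ := by unfold varH; positivity

lemma varP_pos {κ e : ℝ} (hκ : 0 ≤ κ) (he : 0 ≤ e) : 0 < varP κ e := by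
  have := varH_pos hκ
  unfold varP
  split_ifs with h
  · exact this
  · have : 0 < e := lt_of_le_of_ne he (Ne.symm h)
    positivity

/-- The quadratic form `(y - m x)ᴴ (v x xᴴ + I)⁻¹ (y - m x)`. -/
def metricExp {n : ℕ} (v : ℝ) (m : ℂ) (x y : Fin n → ℂ) : ℝ :=
  normSq (y - m • x) - v / (1 + v * normSq x) * ‖star x ⬝ᵥ (y - m • x)‖ ^ 2

/-- The covariance is a rank-one perturbation of the identity: the matrix determinant lemma gives
the normalization and the Sherman–Morrison formula the inverse. -/
lemma cgaussPdf_rank_one {n : ℕ} {v : ℝ} (hv : 0 ≤ v) (m : ℂ) (x y : Fin n → ℂ) :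
    cgaussPdf (fun i => m * x i) ((v : ℂ) • Matrix.vecMulVec x (star x) + 1) y =
      Real.exp (-metricExp v m x y) / (Real.pi ^ n * (1 + v * normSq x)) := by
  have hd : 0 < 1 + v * normSq x := by have := normSq_nonneg x; positivity
  have hd' : (1 + (v : ℂ) * normSq x) ≠ 0 := by exact_mod_cast hd.ne'
  have hxx : star x ⬝ᵥ x = (normSq x : ℂ) := (ofReal_normSq x).symm
  have hdet : ((v : ℂ) • Matrix.vecMulVec x (star x) + 1).det = 1 + (v : ℂ) * normSq x := by
    rw [add_comm, ← Matrix.smul_vecMulVec, Matrix.vecMulVec_eq Unit,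
      Matrix.det_one_add_replicateCol_mul_replicateRow, dotProduct_smul, hxx, smul_eq_mul]
  have hinv : ((v : ℂ) • Matrix.vecMulVec x (star x) + 1)⁻¹ =
      1 - ((v : ℂ) / (1 + (v : ℂ) * normSq x)) • Matrix.vecMulVec x (star x) := by
    refine Matrix.inv_eq_right_inv ?_
    have hPP : Matrix.vecMulVec x (star x) * Matrix.vecMulVec x (star x) =
        (normSq x : ℂ) • Matrix.vecMulVec x (star x) := by
      rw [Matrix.vecMulVec_mul_vecMulVec, hxx, Matrix.vecMulVec_smul]
    generalize Matrix.vecMulVec x (star x) = P at hPP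
    have hc : (v : ℂ) - v / (1 + v * normSq x) - v * (v / (1 + v * normSq x)) * normSq x = 0 := by
      field_simp
      ring
    have hprod : ((v : ℂ) • P + 1) * (1 - ((v : ℂ) / (1 + (v : ℂ) * normSq x)) • P) =
        1 + ((v : ℂ) - v / (1 + v * normSq x) -
          v * (v / (1 + v * normSq x)) * normSq x) • P := by
      rw [add_mul, one_mul, mul_sub, mul_one, smul_mul_assoc, mul_smul_comm, hPP]
      module
    rw [hprod, hc, zero_smul, add_zero]
  unfold cgaussPdf
  have hsub : (y - fun i => m * x i) = y - m • x := rfl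
  rw [hdet, hinv, hsub]
  set u := y - m • x
  have hq : (star u ⬝ᵥ (1 - ((v : ℂ) / (1 + (v : ℂ) * normSq x)) •
      Matrix.vecMulVec x (star x)).mulVec u).re = metricExp v m x y := by
    rw [Matrix.sub_mulVec, Matrix.one_mulVec, Matrix.smul_mulVec, Matrix.vecMulVec_mulVec,
      dotProduct_sub, ← ofReal_normSq, dotProduct_smul]
    have h1 : star u ⬝ᵥ (MulOpposite.op (star x ⬝ᵥ u) • x) = ((‖star x ⬝ᵥ u‖ ^ 2 : ℝ) : ℂ) := by
      rw [dotProduct_smul, Matrix.star_dotProduct u x]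
      simp [Complex.conj_mul']
    rw [h1]
    unfold metricExp
    have h2 : ((v : ℂ) / (1 + (v : ℂ) * normSq x)) = ((v / (1 + v * normSq x) : ℝ) : ℂ) := by
      push_cast
      rfl
    rw [h2, smul_eq_mul, ← Complex.ofReal_mul, Complex.sub_re, Complex.ofReal_re,
      Complex.ofReal_re]
  rw [hq]
  congr 2
  simp

lemma mlMetric_eq {κ e : ℝ} (hκ : 0 ≤ κ) (he : 0 ≤ e) {n : ℕ} (h : ℂ) (x y : Fin n → ℂ) :
    mlMetric κ e h x y = Real.exp (-metricExp (varP κ e) (muP κ e h) x y) /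
      (Real.pi ^ n * (1 + varP κ e * normSq x)) :=
  cgaussPdf_rank_one (varP_pos hκ he).le _ _ _

lemma normSq_sub_smul {n : ℕ} (u x : Fin n → ℂ) (t : ℂ) :
    normSq (u - t • x) =
      normSq u - 2 * (starRingEnd ℂ t * (star x ⬝ᵥ u)).re + ‖t‖ ^ 2 * normSq x := by
  simp only [normSq, dotProduct, Finset.mul_sum, Complex.re_sum, ← Finset.sum_sub_distrib,
    ← Finset.sum_add_distrib]
  refine Finset.sum_congr rfl fun i _ => ?_
  simp only [Pi.sub_apply, Pi.smul_apply, smul_eq_mul, Pi.star_apply, RCLike.star_def,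
    ← Complex.normSq_eq_norm_sq, Complex.normSq_apply, Complex.sub_re, Complex.sub_im,
    Complex.mul_re, Complex.mul_im, Complex.conj_re, Complex.conj_im]
  ring

/-- The left side is a quadratic in `z` with leading coefficient `v⁻¹ + normSq x`; its minimum is
exactly `metricExp`. -/
lemma complete_square {n : ℕ} {v : ℝ} (hv : 0 < v) (m z : ℂ) (x y : Fin n → ℂ) :
    ‖z - m‖ ^ 2 / v + normSq (y - z • x) =
      (v⁻¹ + normSq x) * ‖z - (m + star x ⬝ᵥ (y - m • x) / ((v⁻¹ + normSq x : ℝ) : ℂ))‖ ^ 2 +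
        metricExp v m x y := by
  have he := normSq_nonneg x
  have h1 : y - z • x = (y - m • x) - (z - m) • x := by
    rw [sub_smul]; abel
  unfold metricExp
  rw [h1, normSq_sub_smul (y - m • x)]
  generalize hu : y - m • x = u
  generalize ha : star x ⬝ᵥ u = a
  generalize ht : z - m = t
  have hb : 0 < v⁻¹ + normSq x := by positivity
  have hb' : v / (1 + v * normSq x) = (v⁻¹ + normSq x)⁻¹ := by field_simp
  have ht' : z - (m + a / ((v⁻¹ + normSq x : ℝ) : ℂ)) =
      t - ((v⁻¹ + normSq x)⁻¹ : ℝ) * a := by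
    rw [← ht]
    push_cast
    ring
  rw [hb', ht', div_eq_mul_inv]
  have hvb : v⁻¹ = (v⁻¹ + normSq x) - normSq x := by ring
  rw [hvb]
  generalize hbb : v⁻¹ + normSq x = b at *
  rw [sub_add_cancel]
  simp only [← Complex.normSq_eq_norm_sq, Complex.normSq_apply, Complex.sub_re, Complex.sub_im,
    Complex.mul_re, Complex.mul_im, Complex.conj_re, Complex.conj_im, Complex.ofReal_re,
    Complex.ofReal_im]
  field_simp
  ring

/-- For `s = 1` this gives the channel density. For general `s` it writes the `s`-th power of the
metric as a mixture over `z` in which the codeword enters only through a squared distance. -/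
lemma lintegral_gaussian_mixture {n : ℕ} {v s : ℝ} (hv : 0 < v) (hs : 0 < s) (m : ℂ)
    (x y : Fin n → ℂ) :
    ∫⁻ z : ℂ, ENNReal.ofReal (Real.exp (-(s * (‖z - m‖ ^ 2 / v + normSq (y - z • x))))) =
      ENNReal.ofReal (Real.pi / (s * (v⁻¹ + normSq x)) * Real.exp (-(s * metricExp v m x y))) := by
  have he := normSq_nonneg x
  simp_rw [complete_square hv]
  set t₀ := m + star x ⬝ᵥ (y - m • x) / ((v⁻¹ + normSq x : ℝ) : ℂ)
  have h : ∀ z : ℂ, ENNReal.ofReal (Real.exp (-(s * ((v⁻¹ + normSq x) * ‖z - t₀‖ ^ 2 +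
      metricExp v m x y)))) = ENNReal.ofReal (Real.exp (-(s * metricExp v m x y))) *
        ENNReal.ofReal (Real.exp (-((s * (v⁻¹ + normSq x)) * ‖z - t₀‖ ^ 2))) := by
    intro z
    rw [← ENNReal.ofReal_mul (Real.exp_pos _).le, ← Real.exp_add]
    congr 2
    ring
  simp_rw [h]
  rw [lintegral_const_mul _ (by fun_prop), lintegral_exp_neg_mul_norm_sq (by positivity),
    ← ENNReal.ofReal_mul (Real.exp_pos _).le, mul_comm]

lemma metricExp_nonneg {n : ℕ} {v : ℝ} (hv : 0 < v) (m : ℂ) (x y : Fin n → ℂ) :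
    0 ≤ metricExp v m x y := by
  have h := complete_square hv m
    (m + star x ⬝ᵥ (y - m • x) / ((v⁻¹ + normSq x : ℝ) : ℂ)) x y
  rw [sub_self, norm_zero] at h
  have h2 := normSq_nonneg
    (y - (m + star x ⬝ᵥ (y - m • x) / ((v⁻¹ + normSq x : ℝ) : ℂ)) • x)
  have h3 : 0 ≤ ‖m + star x ⬝ᵥ (y - m • x) / ((v⁻¹ + normSq x : ℝ) : ℂ) - m‖ ^ 2 / v := by
    positivity
  nlinarith

lemma IsUnitaryMap.metricExp_apply {n : ℕ} {L : (Fin n → ℂ) →ₗ[ℂ] (Fin n → ℂ)}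
    (hL : IsUnitaryMap L) (v : ℝ) (m : ℂ) (x y : Fin n → ℂ) :
    metricExp v m (L x) (L y) = metricExp v m x y := by
  unfold metricExp
  rw [← L.map_smul, ← L.map_sub, hL.normSq_apply, hL.normSq_apply, hL]

lemma measurable_metricExp {n : ℕ} (v : ℝ) :
    Measurable fun p : ℂ × (Fin n → ℂ) × (Fin n → ℂ) => metricExp v p.1 p.2.1 p.2.2 := by
  unfold metricExp
  have h : Measurable fun p : ℂ × (Fin n → ℂ) × (Fin n → ℂ) =>
      star p.2.1 ⬝ᵥ (p.2.2 - p.1 • p.2.1) :=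
    continuous_star_dotProduct.measurable.comp
      (by fun_prop : Measurable fun p : ℂ × (Fin n → ℂ) × (Fin n → ℂ) =>
        (p.2.1, p.2.2 - p.1 • p.2.1))
  fun_prop

lemma measurable_metricExp_comp {n : ℕ} {α : Type*} [MeasurableSpace α] {v : ℝ} {m : α → ℂ}
    {x y : α → Fin n → ℂ} (hm : Measurable m) (hx : Measurable x) (hy : Measurable y) :
    Measurable fun a => metricExp v (m a) (x a) (y a) := by
  have h := (measurable_metricExp v).comp (hm.prodMk (hx.prodMk hy))
  exact h

/-! ### The density of the fading channel -/

/-- The law of `Z x + W` for independent `Z ∼ CN(m, v)` and `W ∼ CN(0, I)`. -/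
def fadingLaw (m : ℂ) (v : ℝ) {n : ℕ} (x : Fin n → ℂ) : Measure (Fin n → ℂ) :=
  ((cgauss m v).prod (noiseLaw n)).map fun ω i => ω.1 * x i + ω.2 i

lemma measurable_noisePdf_sub_smul {n : ℕ} (x : Fin n → ℂ) :
    Measurable fun p : ℂ × (Fin n → ℂ) => noisePdf (p.2 - p.1 • x) :=
  measurable_noisePdf.comp
    (by fun_prop : Measurable fun p : ℂ × (Fin n → ℂ) => p.2 - p.1 • x)

lemma lintegral_fadingLaw {n : ℕ} (m : ℂ) (v : ℝ) (x : Fin n → ℂ) {f : (Fin n → ℂ) → ℝ≥0∞}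
    (hf : Measurable f) :
    ∫⁻ y, f y ∂(fadingLaw m v x) = ∫⁻ y, (∫⁻ z, noisePdf (y - z • x) ∂(cgauss m v)) * f y := by
  have hg : Measurable fun ω : ℂ × (Fin n → ℂ) => (fun i => ω.1 * x i + ω.2 i : Fin n → ℂ) := by
    fun_prop
  have hp := measurable_noisePdf_sub_smul x
  unfold fadingLaw
  rw [lintegral_map hf hg, lintegral_prod
    (fun ω : ℂ × (Fin n → ℂ) => f fun i => ω.1 * x i + ω.2 i) (hf.comp hg).aemeasurable]
  have h1 : ∀ z : ℂ, ∫⁻ w, f (fun i => z * x i + w i) ∂(noiseLaw n) =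
      ∫⁻ y, noisePdf (y - z • x) * f y := by
    intro z
    have hz : Measurable fun w : Fin n → ℂ => f (fun i => z * x i + w i) :=
      (hf.comp hg).comp (measurable_const.prodMk measurable_id)
    rw [lintegral_noiseLaw hz,
      ← lintegral_add_right_eq_self (fun y => noisePdf (y - z • x) * f y) (z • x)]
    refine lintegral_congr fun w => ?_
    rw [add_sub_cancel_right, add_comm w]
    rfl
  simp_rw [h1]
  have hpf : Measurable fun p : ℂ × (Fin n → ℂ) => noisePdf (p.2 - p.1 • x) * f p.2 :=
    hp.mul (hf.comp measurable_snd)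
  rw [lintegral_lintegral_swap hpf.aemeasurable]
  refine lintegral_congr fun y => ?_
  have hy : Measurable fun z : ℂ => noisePdf (y - z • x) :=
    measurable_noisePdf.comp (by fun_prop : Measurable fun z : ℂ => y - z • x)
  rw [lintegral_mul_const _ hy]

lemma lintegral_noisePdf_cgauss {n : ℕ} {v : ℝ} (hv : 0 < v) (m : ℂ) (x y : Fin n → ℂ) :
    ∫⁻ z, noisePdf (y - z • x) ∂(cgauss m v) = ENNReal.ofReal
      (Real.exp (-metricExp v m x y) / (Real.pi ^ n * (1 + v * normSq x))) := by
  have he := normSq_nonneg x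
  have hy : Measurable fun z : ℂ => noisePdf (y - z • x) :=
    measurable_noisePdf.comp (by fun_prop : Measurable fun z : ℂ => y - z • x)
  rw [cgauss_eq_withDensity m hv, lintegral_withDensity_eq_lintegral_mul _ (by fun_prop) hy]
  have h2 : ∀ z : ℂ, ENNReal.ofReal (Real.exp (-(‖z - m‖ ^ 2 / v)) / (Real.pi * v)) *
      noisePdf (y - z • x) = ENNReal.ofReal (Real.pi ^ (n + 1) * v)⁻¹ *
        ENNReal.ofReal (Real.exp (-(1 * (‖z - m‖ ^ 2 / v + normSq (y - z • x))))) := by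
    intro z
    unfold noisePdf
    rw [← ENNReal.ofReal_mul (by positivity), ← ENNReal.ofReal_mul (by positivity)]
    congr 1
    rw [one_mul, neg_add, Real.exp_add]
    field_simp
    ring
  simp only [Pi.mul_apply, h2]
  rw [lintegral_const_mul _ (by fun_prop), lintegral_gaussian_mixture hv one_pos,
    ← ENNReal.ofReal_mul (by positivity)]
  congr 1
  rw [one_mul, one_mul]
  field_simp
  ring

lemma fadingLaw_eq_withDensity {n : ℕ} {v : ℝ} (hv : 0 < v) (m : ℂ) (x : Fin n → ℂ) :
    fadingLaw m v x = volume.withDensity fun y => ENNReal.ofReal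
      (Real.exp (-metricExp v m x y) / (Real.pi ^ n * (1 + v * normSq x))) := by
  ext s hs
  have h := lintegral_fadingLaw m v x (measurable_const.indicator hs :
    Measurable (s.indicator fun _ => (1 : ℝ≥0∞)))
  rw [lintegral_indicator_const hs, one_mul] at h
  rw [h, withDensity_apply _ hs, ← lintegral_indicator hs]
  refine lintegral_congr fun y => ?_
  rw [lintegral_noisePdf_cgauss hv]
  by_cases hy : y ∈ s
  · simp [hy]
  · simp [hy]

lemma eqChannelLaw_eq_withDensity {κ e : ℝ} (hκ : 0 ≤ κ) (he : 0 ≤ e) {n : ℕ} (h : ℂ)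
    (x : Fin n → ℂ) : eqChannelLaw κ e h x =
      volume.withDensity fun y => ENNReal.ofReal (mlMetric κ e h x y) := by
  simp_rw [mlMetric_eq hκ he]
  exact fadingLaw_eq_withDensity (varP_pos hκ he) _ _

/-! ### The law of the estimate and the equivalent channel -/

lemma measurable_append {m n : ℕ} :
    Measurable fun w : (Fin m → ℂ) × (Fin n → ℂ) => Fin.append w.1 w.2 := by
  refine measurable_pi_lambda _ fun i => ?_
  refine Fin.addCases (fun j => ?_) (fun j => ?_) i
  · simp only [Fin.append_left]; fun_prop
  · simp only [Fin.append_right]; fun_prop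

lemma noiseLaw_prod_map_append (m n : ℕ) :
    ((noiseLaw m).prod (noiseLaw n)).map (fun w => Fin.append w.1 w.2) = noiseLaw (m + n) := by
  have hm := measurable_append (m := m) (n := n)
  refine (Measure.pi_eq fun s hs => ?_).symm
  rw [Measure.map_apply hm (MeasurableSet.univ_pi hs)]
  have h : (fun w : (Fin m → ℂ) × (Fin n → ℂ) => Fin.append w.1 w.2) ⁻¹' (Set.univ.pi s) =
      (Set.univ.pi fun i => s (Fin.castAdd n i)) ×ˢ (Set.univ.pi fun i => s (Fin.natAdd m i)) := by
    ext w
    simp only [Set.mem_preimage, Set.mem_pi, Set.mem_univ, true_implies, Set.mem_prod]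
    rw [Fin.forall_fin_add]
    simp
  rw [h, Measure.prod_prod, Fin.prod_univ_add]
  unfold noiseLaw
  rw [Measure.pi_pi, Measure.pi_pi]

lemma cgauss_prod_cgauss (m₀ m₁ : ℂ) {a b : ℝ} (ha : 0 ≤ a) (hb : 0 ≤ b) :
    (cgauss m₀ a).prod (cgauss m₁ b) = (noiseLaw 2).map fun g =>
      (m₀ + (Real.sqrt a : ℂ) * g 0, m₁ + (Real.sqrt b : ℂ) * g 1) := by
  have h : (noiseLaw 2).map (fun g => (g 0, g 1)) = (cgauss 0 1).prod (cgauss 0 1) :=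
    (measurePreserving_finTwoArrow (cgauss 0 1)).map_eq
  rw [cgauss_eq_map m₀ ha, cgauss_eq_map m₁ hb, Measure.map_prod_map _ _ (by fun_prop)
    (by fun_prop), ← h, Measure.map_map (by fun_prop) (by fun_prop)]
  rfl

/-- The sum of two independent complex Gaussians is independent of the residual in the estimation
of the first one from it. -/
lemma cgauss_prod_map_add_residual (m : ℂ) {a b : ℝ} (ha : 0 < a) (hb : 0 < b) :
    ((cgauss m a).prod (cgauss 0 b)).map
        (fun p => (p.1 + p.2, p.1 - ((a : ℂ) * (p.1 + p.2) + (b : ℂ) * m) / ((a + b : ℝ) : ℂ))) =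
      (cgauss m (a + b)).prod (cgauss 0 (a * b / (a + b))) := by
  have hab : 0 < a + b := by positivity
  set α : ℂ := (Real.sqrt a : ℂ)
  set β : ℂ := (Real.sqrt b : ℂ)
  set γ : ℂ := (Real.sqrt (a + b) : ℂ)
  have hα : α * α = a := by simp only [α]; rw [← Complex.ofReal_mul, Real.mul_self_sqrt ha.le]
  have hβ : β * β = b := by simp only [β]; rw [← Complex.ofReal_mul, Real.mul_self_sqrt hb.le]
  have hγ : γ * γ = a + b := by
    simp only [γ]; rw [← Complex.ofReal_mul, Real.mul_self_sqrt hab.le]; push_cast; rfl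
  have hγ0 : γ ≠ 0 := by
    simp only [γ]
    exact_mod_cast (Real.sqrt_pos.2 hab).ne'
  have hd : (Real.sqrt (a * b / (a + b)) : ℂ) = α * β / γ := by
    rw [Real.sqrt_div (by positivity), Real.sqrt_mul ha.le]
    push_cast
    rfl
  -- The first row is the normalized centred sum; the orthogonal second row is the residual divided
  -- by its standard deviation `α * β / γ`.
  let L : (Fin 2 → ℂ) →ₗ[ℂ] (Fin 2 → ℂ) := Matrix.toLin' !![α / γ, β / γ; β / γ, -α / γ]
  have hL0 : ∀ g, L g 0 = (α * g 0 + β * g 1) / γ := fun g => by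
    simp [L, Matrix.toLin'_apply, Matrix.mulVec, dotProduct, Fin.sum_univ_two]
    ring
  have hL1 : ∀ g, L g 1 = (β * g 0 - α * g 1) / γ := fun g => by
    simp [L, Matrix.toLin'_apply, Matrix.mulVec, dotProduct, Fin.sum_univ_two]
    ring
  have hL : IsUnitaryMap L := fun x y => by
    simp only [dotProduct, Fin.sum_univ_two, Pi.star_apply, hL0, hL1, RCLike.star_def, map_div₀,
      map_add, map_sub, map_mul, α, β, γ, Complex.conj_ofReal]
    change (α * _ + β * _) / γ * ((α * _ + β * _) / γ) + (β * _ - α * _) / γ * ((β * _ - α * _) / γ)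
      = _
    field_simp
    have hγ2 : γ ^ 2 = α * α + β * β := by rw [pow_two, hγ, hα, hβ]
    rw [hγ2]
    ring
  rw [cgauss_prod_cgauss m 0 ha.le hb.le, cgauss_prod_cgauss m 0 hab.le (by positivity),
    Measure.map_map (by fun_prop) (by fun_prop)]
  conv_rhs => rw [← hL.map_noiseLaw]
  rw [Measure.map_map (by fun_prop) (IsUnitaryMap.measurable L)]
  congr 1
  funext g
  simp only [Function.comp, hL0, hL1, hd]
  change (m + α * g 0 + (0 + β * g 1), _) = (m + γ * _, _)
  have hab' : ((a + b : ℝ) : ℂ) = γ * γ := by rw [hγ]; push_cast; rfl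
  refine Prod.ext ?_ ?_
  · simp only
    field_simp
    ring
  · simp only
    rw [hab', ← hα, ← hβ]
    have : γ * γ = α * α + β * β := by rw [hγ, hα, hβ]
    field_simp
    have h2 : γ ^ 2 = α * α + β * β := by rw [pow_two, this]
    change (m + α * g 0) * γ ^ 2 - _ = _
    rw [h2]
    ring

/-- The law of the estimate `Ĥ` for the pilot energy `e`. -/
def estimateLaw (κ e : ℝ) : Measure ℂ :=
  if e = 0 then Measure.dirac 0 else cgauss (muH κ) (varH κ + e⁻¹)

instance (κ e : ℝ) : IsProbabilityMeasure (estimateLaw κ e) := by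
  unfold estimateLaw; split_ifs <;> infer_instance

/-- The estimate and the data part of the channel output in one block, when the pilots `xp` and the
data vector `xd` are sent. -/
def blockObs {np nd : ℕ} (xp : Fin np → ℂ) (xd : Fin nd → ℂ) (ω : ℂ × (Fin (np + nd) → ℂ)) :
    ℂ × (Fin nd → ℂ) :=
  (mlEstimate xp (pilotPart fun i => ω.1 * Fin.append xp xd i + ω.2 i),
    dataPart fun i => ω.1 * Fin.append xp xd i + ω.2 i)

lemma blockObs_append {np nd : ℕ} (xp : Fin np → ℂ) (xd : Fin nd → ℂ) (h : ℂ)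
    (wp : Fin np → ℂ) (wd : Fin nd → ℂ) :
    blockObs xp xd (h, Fin.append wp wd) = ((h * normSq xp + star xp ⬝ᵥ wp) / (normSq xp : ℂ),
      fun i => h * xd i + wd i) := by
  unfold blockObs mlEstimate pilotPart dataPart
  simp only [Fin.append_left, Fin.append_right]
  rw [ofReal_normSq, ← smul_eq_mul, ← dotProduct_smul, ← dotProduct_add]
  rfl

lemma measurable_blockObs {np nd : ℕ} (xp : Fin np → ℂ) :
    Measurable fun p : (Fin nd → ℂ) × (ℂ × (Fin (np + nd) → ℂ)) => blockObs xp p.1 p.2 := by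
  unfold blockObs mlEstimate pilotPart dataPart
  simp only [Fin.append_left, Fin.append_right, dotProduct, Pi.star_apply]
  fun_prop

lemma measurable_blockObs_right {np nd : ℕ} (xp : Fin np → ℂ) (xd : Fin nd → ℂ) :
    Measurable (blockObs xp xd) := by
  unfold blockObs mlEstimate pilotPart dataPart
  simp only [Fin.append_left, Fin.append_right, dotProduct, Pi.star_apply]
  fun_prop

lemma measurable_muP (κ e : ℝ) : Measurable (muP κ e) := by
  unfold muP
  split_ifs <;> fun_prop

lemma blockLaw_map_blockObs_eq {np nd : ℕ} (κ : ℝ) (xp : Fin np → ℂ) (xd : Fin nd → ℂ) :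
    (blockLaw κ (np + nd)).map (blockObs xp xd) =
      ((cgauss (muH κ) (varH κ)).prod ((noiseLaw np).prod (noiseLaw nd))).map fun p =>
        ((p.1 * normSq xp + star xp ⬝ᵥ p.2.1) / (normSq xp : ℂ), fun i => p.1 * xd i + p.2.2 i) := by
  unfold blockLaw
  have hobs := measurable_blockObs_right xp xd
  have hid : cgauss (muH κ) (varH κ) = (cgauss (muH κ) (varH κ)).map id := Measure.map_id.symm
  conv_lhs => rw [hid]
  rw [← noiseLaw_prod_map_append, Measure.map_prod_map _ _ measurable_id measurable_append,
    Measure.map_map hobs (measurable_id.prodMap measurable_append)]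
  congr 1
  funext p
  exact blockObs_append xp xd _ _ _

/-- The fading coefficient is traded for the independent pair of estimate and residual: it equals
`muP` of the estimate plus a residual of variance `varP`. -/
lemma blockLaw_map_blockObs {np nd : ℕ} {κ : ℝ} (hκ : 0 ≤ κ) (xp : Fin np → ℂ)
    (xd : Fin nd → ℂ) :
    (blockLaw κ (np + nd)).map (blockObs xp xd) =
      ((estimateLaw κ (normSq xp)).prod
        ((cgauss 0 (varP κ (normSq xp))).prod (noiseLaw nd))).map fun p =>
          (p.1, fun i => (muP κ (normSq xp) p.1 + p.2.1) * xd i + p.2.2 i) := by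
  rw [blockLaw_map_blockObs_eq]
  set e := normSq xp
  have he0 : 0 ≤ e := normSq_nonneg xp
  have hH := varH_pos hκ
  have hmu := measurable_muP κ e
  -- Without pilot energy `mlEstimate` divides by zero and returns `0`; the residual is then the
  -- whole centred fading coefficient.
  by_cases he : e = 0
  · have hxp : xp = 0 := normSq_eq_zero.1 he
    unfold estimateLaw
    have hmu0 := measurable_muP κ 0
    simp only [he, if_true, Complex.ofReal_zero, div_zero]
    rw [Measure.dirac_prod, Measure.map_map (by fun_prop) (by fun_prop)]
    have h1 : cgauss 0 (varP κ 0) = (cgauss 0 1).map fun z => 0 + (Real.sqrt (varH κ) : ℂ) * z := by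
      rw [← cgauss_eq_map 0 hH.le]
      simp [varP]
    have h2 : noiseLaw nd = (noiseLaw nd).map id := Measure.map_id.symm
    have h3 : noiseLaw nd = ((noiseLaw np).prod (noiseLaw nd)).map Prod.snd := by
      rw [Measure.map_snd_prod]
      simp
    have h4 : (cgauss 0 1).prod (noiseLaw nd) =
        ((cgauss 0 1).prod ((noiseLaw np).prod (noiseLaw nd))).map (Prod.map id Prod.snd) := by
      conv_lhs => rw [h3, ← Measure.map_id (μ := cgauss 0 1)]
      rw [Measure.map_prod_map _ _ measurable_id measurable_snd]
    have h5 : (noiseLaw np).prod (noiseLaw nd) = ((noiseLaw np).prod (noiseLaw nd)).map id :=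
      Measure.map_id.symm
    rw [h1]
    conv_rhs => rw [h2]
    rw [Measure.map_prod_map _ _ (by fun_prop) measurable_id, h4,
      Measure.map_map (by fun_prop) (by fun_prop), Measure.map_map (by fun_prop) (by fun_prop)]
    conv_lhs => rw [h5]
    rw [cgauss_eq_map (muH κ) hH.le, Measure.map_prod_map _ _ (by fun_prop) measurable_id,
      Measure.map_map (by fun_prop) (by fun_prop)]
    congr 1
    funext p
    simp [muP]
  · have hepos : 0 < e := lt_of_le_of_ne he0 (Ne.symm he)
    have hec : (e : ℂ) ≠ 0 := by exact_mod_cast he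
    have hnp : NeZero np := ⟨by
      rintro rfl
      exact he (by simp [e, normSq])⟩
    -- The projected pilot noise has variance `e`, and dividing by `e` leaves `e / e ^ 2`.
    have h1 : (noiseLaw np).map (fun w => (star xp ⬝ᵥ w) / (e : ℂ)) = cgauss 0 e⁻¹ := by
      have : (fun w => (star xp ⬝ᵥ w) / (e : ℂ)) =
          (fun z : ℂ => z / (e : ℂ)) ∘ fun w => star xp ⬝ᵥ w := rfl
      rw [this, ← Measure.map_map (by fun_prop) (by fun_prop), noiseLaw_map_dotProduct,
        cgauss_eq_map 0 he0, cgauss_eq_map 0 (inv_nonneg.2 he0),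
        Measure.map_map (by fun_prop) (by fun_prop)]
      congr 1
      funext z
      have hs : (Real.sqrt e : ℂ) ≠ 0 := by exact_mod_cast (Real.sqrt_pos.2 hepos).ne'
      have hss : (Real.sqrt e : ℂ) * Real.sqrt e = e := by
        rw [← Complex.ofReal_mul, Real.mul_self_sqrt he0]
      simp only [Function.comp, zero_add, Real.sqrt_inv, Complex.ofReal_inv]
      rw [← hss]
      field_simp
    have h2 := cgauss_prod_map_add_residual (muH κ) hH (inv_pos.2 hepos)
    have hest : estimateLaw κ e = cgauss (muH κ) (varH κ + e⁻¹) := if_neg he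
    have hvp : varP κ e = varH κ * e⁻¹ / (varH κ + e⁻¹) := if_neg he
    rw [hest, hvp]
    have h3 : ∀ μ ν : Measure ℂ, ∀ _ : IsProbabilityMeasure μ, ∀ _ : IsProbabilityMeasure ν,
        μ.prod (ν.prod (noiseLaw nd)) =
        ((μ.prod ν).prod (noiseLaw nd)).map fun q => (q.1.1, (q.1.2, q.2)) := fun μ ν _ _ =>
      (measurePreserving_prodAssoc μ ν (noiseLaw nd)).map_eq.symm
    rw [h3 (cgauss (muH κ) _) (cgauss 0 _) inferInstance inferInstance, ← h2, ← h1]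
    have hn : noiseLaw nd = (noiseLaw nd).map id := Measure.map_id.symm
    have hdot : Measurable fun w : Fin np → ℂ => (star xp ⬝ᵥ w) / (e : ℂ) := by fun_prop
    have h4 : ((cgauss (muH κ) (varH κ)).prod ((noiseLaw np).map
        (fun w => (star xp ⬝ᵥ w) / (e : ℂ)))).prod (noiseLaw nd) =
        ((cgauss (muH κ) (varH κ)).prod ((noiseLaw np).prod (noiseLaw nd))).map fun p =>
          ((p.1, (star xp ⬝ᵥ p.2.1) / (e : ℂ)), p.2.2) := by
      have hid : cgauss (muH κ) (varH κ) = (cgauss (muH κ) (varH κ)).map id := Measure.map_id.symm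
      have hassoc := (measurePreserving_prodAssoc (cgauss (muH κ) (varH κ)) (noiseLaw np)
        (noiseLaw nd)).map_eq
      rw [← hassoc, Measure.map_map (by fun_prop) (MeasurableEquiv.measurable _)]
      conv_lhs => rw [hn, hid]
      rw [Measure.map_prod_map _ _ measurable_id hdot,
        Measure.map_prod_map _ _ (measurable_id.prodMap hdot) measurable_id]
      rfl
    conv_rhs => rw [hn]
    have hmm : Measurable fun p : ℂ × ℂ => (p.1 + p.2, p.1 - ((varH κ : ℂ) * (p.1 + p.2) +
      ((e⁻¹ : ℝ) : ℂ) * muH κ) / ((varH κ + e⁻¹ : ℝ) : ℂ)) := by fun_prop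
    rw [Measure.map_prod_map _ _ hmm measurable_id, h4, Measure.map_map (by fun_prop) (by fun_prop),
      Measure.map_map (by fun_prop) (by fun_prop), Measure.map_map (by fun_prop) (by fun_prop)]
    congr 1
    funext p
    simp only [Function.comp, Prod.map, id]
    refine Prod.ext ?_ ?_
    · simp only
      field_simp
    · funext i
      simp only [muP, if_neg he]
      ring

/-! ### Kernels and the conditional law of the data part -/

lemma measurable_measure_map {α Ω β : Type*} [MeasurableSpace α] [MeasurableSpace Ω]
    [MeasurableSpace β] (P : Measure Ω) [SFinite P] {f : α × Ω → β} (hf : Measurable f) :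
    Measurable fun a => P.map fun ω => f (a, ω) := by
  refine Measure.measurable_of_measurable_coe _ fun s hs => ?_
  have h : (fun a => P.map (fun ω => f (a, ω)) s) = fun a => P (Prod.mk a ⁻¹' (f ⁻¹' s)) := by
    funext a
    have hfa : Measurable fun ω => f (a, ω) := hf.comp measurable_prodMk_left
    rw [Measure.map_apply hfa hs]
    rfl
  rw [h]
  exact measurable_measure_prodMk_left (hf hs)

/-- The map sending a parameter `a` to the law of `f (a, ω)`, as a kernel. -/
def mapKernel {α Ω β : Type*} [MeasurableSpace α] [MeasurableSpace Ω]
    [MeasurableSpace β] (P : Measure Ω) [SFinite P] (f : α × Ω → β) (hf : Measurable f) :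
    Kernel α β := ⟨fun a => P.map fun ω => f (a, ω), measurable_measure_map P hf⟩

instance {α Ω β : Type*} [MeasurableSpace α] [MeasurableSpace Ω]
    [MeasurableSpace β] (P : Measure Ω) [IsProbabilityMeasure P] (f : α × Ω → β)
    (hf : Measurable f) : IsMarkovKernel (mapKernel P f hf) :=
  ⟨fun _ => Measure.isProbabilityMeasure_map (hf.comp measurable_prodMk_left).aemeasurable⟩

lemma compProd_mapKernel {α Ω β : Type*} [MeasurableSpace α] [MeasurableSpace Ω]
    [MeasurableSpace β] (μ : Measure α) [SFinite μ] (P : Measure Ω) [IsProbabilityMeasure P]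
    (f : α × Ω → β) (hf : Measurable f) :
    μ ⊗ₘ mapKernel P f hf = (μ.prod P).map fun p => (p.1, f p) := by
  ext s hs
  have hm : Measurable fun p : α × Ω => (p.1, f p) := measurable_fst.prodMk hf
  rw [Measure.compProd_apply hs, Measure.map_apply hm hs, Measure.prod_apply (hm hs)]
  refine lintegral_congr fun a => ?_
  change P.map (fun ω => f (a, ω)) _ = _
  have hfa : Measurable fun ω => f (a, ω) := hf.comp measurable_prodMk_left
  rw [Measure.map_apply hfa (measurable_prodMk_left hs)]
  rfl

lemma fadingLaw_eq_map {n : ℕ} (m : ℂ) {v : ℝ} (hv : 0 ≤ v) (x : Fin n → ℂ) :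
    fadingLaw m v x = ((cgauss 0 v).prod (noiseLaw n)).map fun ω i => (m + ω.1) * x i + ω.2 i := by
  unfold fadingLaw
  have hid : noiseLaw n = (noiseLaw n).map id := Measure.map_id.symm
  have h : cgauss m v = (cgauss 0 v).map fun z => m + z := by
    rw [cgauss_eq_map m hv, cgauss_eq_map 0 hv, Measure.map_map (by fun_prop) (by fun_prop)]
    simp [Function.comp_def]
  conv_lhs => rw [h, hid]
  rw [Measure.map_prod_map _ _ (by fun_prop) measurable_id,
    Measure.map_map (by fun_prop) (by fun_prop)]
  rfl

lemma blockLaw_map_fst_blockObs {np nd : ℕ} {κ : ℝ} (hκ : 0 ≤ κ) (xp : Fin np → ℂ)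
    (xd : Fin nd → ℂ) :
    (blockLaw κ (np + nd)).map (fun ω => (blockObs xp xd ω).1) = estimateLaw κ (normSq xp) := by
  have hobs := measurable_blockObs_right xp xd
  have hmu := measurable_muP κ (normSq xp)
  have h := congrArg (Measure.map Prod.fst) (blockLaw_map_blockObs hκ xp xd)
  rw [Measure.map_map (by fun_prop) hobs, Measure.map_map (by fun_prop) (by fun_prop)] at h
  change Measure.map (fun ω => (blockObs xp xd ω).1) _ = Measure.map Prod.fst _ at h
  rw [h, Measure.map_fst_prod]
  simp

/-- The joint law is the law of the estimate composed with an explicit kernel, and disintegrations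
are almost everywhere unique. -/
lemma condDistrib_blockObs {np nd : ℕ} {κ : ℝ} (hκ : 0 ≤ κ) (xp : Fin np → ℂ)
    (xd : Fin nd → ℂ) :
    ∀ᵐ h ∂((blockLaw κ (np + nd)).map fun ω => (blockObs xp xd ω).1),
      condDistrib (fun ω => (blockObs xp xd ω).2) (fun ω => (blockObs xp xd ω).1)
        (blockLaw κ (np + nd)) h = eqChannelLaw κ (normSq xp) h xd := by
  set e := normSq xp
  have hobs := measurable_blockObs_right xp xd
  have hmu := measurable_muP κ e
  have hf : Measurable fun p : ℂ × (ℂ × (Fin nd → ℂ)) =>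
      (fun i => (muP κ e p.1 + p.2.1) * xd i + p.2.2 i : Fin nd → ℂ) := by fun_prop
  have h := condDistrib_ae_eq_of_measure_eq_compProd_of_measurable (μ := blockLaw κ (np + nd))
    (measurable_fst.comp hobs) (measurable_snd.comp hobs)
    (κ := mapKernel ((cgauss 0 (varP κ e)).prod (noiseLaw nd)) _ hf) (by
      rw [compProd_mapKernel]
      exact (blockLaw_map_blockObs hκ xp xd).trans (by
        rw [← blockLaw_map_fst_blockObs hκ xp xd]; rfl))
  filter_upwards [h] with a ha
  exact ha.trans (fadingLaw_eq_map (muP κ e a) (varP_pos hκ (normSq_nonneg xp)).le xd).symm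

/-! ### The information density -/

lemma lintegral_comp_mul_unit {u : ℂ} (hu : ‖u‖ = 1) {f : ℂ → ℝ≥0∞} (hf : Measurable f) :
    ∫⁻ z, f (u * z) = ∫⁻ z, f z := by
  let a : Circle := ⟨u, mem_sphere_zero_iff_norm.2 hu⟩
  have h := (rotation a).measurePreserving.lintegral_comp hf
  refine Eq.trans (lintegral_congr fun z => ?_) h
  exact congrArg f (rotation_apply a z).symm

/-- Averaging over the phase of `z`, that is over `sphereLaw 1`, turns the exponential into `I_0` of
a radial quantity. -/
lemma lintegral_radial_mul_exp {G : ℝ → ℝ≥0∞} (hG : Measurable G) (c : ℂ) :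
    ∫⁻ z : ℂ, G (‖z‖ ^ 2) * ENNReal.ofReal (Real.exp (2 * (starRingEnd ℂ z * c).re)) =
      ENNReal.ofReal Real.pi * ∫⁻ t in Set.Ioi (0 : ℝ),
        G t * ENNReal.ofReal (besselSeries 0 (Real.sqrt t * ‖c‖)) := by
  set F : ℂ → ℝ≥0∞ := fun z =>
    G (‖z‖ ^ 2) * ENNReal.ofReal (Real.exp (2 * (starRingEnd ℂ z * c).re))
  have hF : Measurable F := by fun_prop
  have h1 : ∫⁻ z, F z = ∫⁻ u, ∫⁻ z, F (u 0 * z) ∂volume ∂(sphereLaw 1) := by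
    have h : ∀ᵐ u ∂(sphereLaw 1), ∫⁻ z, F (u 0 * z) = ∫⁻ z, F z := by
      filter_upwards [ae_normSq_sphereLaw 1] with u hu
      refine lintegral_comp_mul_unit ?_ hF
      simp only [normSq, Fin.sum_univ_one] at hu
      exact (pow_eq_one_iff_of_nonneg (norm_nonneg _) two_ne_zero).1 hu
    rw [lintegral_congr_ae h, lintegral_const, measure_univ, mul_one]
  have hFm : Measurable fun p : (Fin 1 → ℂ) × ℂ => F (p.1 0 * p.2) := by fun_prop
  rw [h1, lintegral_lintegral_swap hFm.aemeasurable]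
  have h2 : ∀ z : ℂ, ∫⁻ u, F (u 0 * z) ∂(sphereLaw 1) =
      (fun t => G t * ENNReal.ofReal (besselSeries 0 (Real.sqrt t * ‖c‖))) (‖z‖ ^ 2) := by
    intro z
    have h3 : ∀ᵐ u ∂(sphereLaw 1), F (u 0 * z) = G (‖z‖ ^ 2) * ENNReal.ofReal
        (Real.exp (2 * (star (fun _ : Fin 1 => starRingEnd ℂ z * c) ⬝ᵥ u).re)) := by
      filter_upwards [ae_normSq_sphereLaw 1] with u hu
      simp only [normSq, Fin.sum_univ_one] at hu
      simp only [F, norm_mul, mul_pow, hu, one_mul, dotProduct, Fin.sum_univ_one, Pi.star_apply,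
        RCLike.star_def]
      congr 4
      rw [← Complex.conj_re]
      simp only [map_mul, Complex.conj_conj]
      ring_nf
    rw [lintegral_congr_ae h3, lintegral_const_mul _ (by fun_prop), lintegral_sphereLaw_exp]
    simp only [normSq, Fin.sum_univ_one, Real.sqrt_sq (norm_nonneg _), norm_mul, RCLike.norm_conj]
    rw [Real.sqrt_sq (by positivity)]
    simp
  simp_rw [h2]
  rw [lintegral_radial (fun t => G t * ENNReal.ofReal (besselSeries 0 (Real.sqrt t * ‖c‖)))
    (by fun_prop)]

/-- The integrand in the definition of the information density. -/
def densIntegrand {n : ℕ} (ρ : ℝ) (m : ℂ) (v s : ℝ) (y : Fin n → ℂ) (z : ℝ) : ℝ :=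
  Real.exp (-(s * (ρ * n + v⁻¹) * z))
    * besselQuot (n - 1) s (Real.sqrt (normSq y) * Real.sqrt (ρ * n * z))
    * besselI 0 (2 * s * v⁻¹ * Real.sqrt (z * ‖m‖ ^ 2))

lemma densIntegrand_eq {n : ℕ} (ρ : ℝ) (m : ℂ) (v s : ℝ) (y : Fin n → ℂ) (z : ℝ) :
    densIntegrand ρ m v s y z = s ^ (n - 1) * (Real.exp (-(s * (ρ * n + v⁻¹) * z)) *
      besselSeries (n - 1) (s * (Real.sqrt (normSq y) * Real.sqrt (ρ * n * z))) *
        besselSeries 0 (s * v⁻¹ * Real.sqrt (z * ‖m‖ ^ 2))) := by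
  unfold densIntegrand
  rw [besselQuot_eq, besselI_zero_eq,
    show 2 * s * v⁻¹ * Real.sqrt (z * ‖m‖ ^ 2) / 2 = s * v⁻¹ * Real.sqrt (z * ‖m‖ ^ 2) by ring]
  ring

lemma densIntegrand_nonneg {n : ℕ} (ρ : ℝ) (m : ℂ) {v s : ℝ} (hs : 0 ≤ s)
    (y : Fin n → ℂ) (z : ℝ) : 0 ≤ densIntegrand ρ m v s y z := by
  rw [densIntegrand_eq]
  have h1 := besselSeries_nonneg (n - 1) (s * (Real.sqrt (normSq y) * Real.sqrt (ρ * n * z)))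
  have h2 := besselSeries_nonneg 0 (s * v⁻¹ * Real.sqrt (z * ‖m‖ ^ 2))
  have h3 := pow_nonneg hs (n - 1)
  positivity

lemma measurable_densIntegrand {n : ℕ} (ρ : ℝ) (m : ℂ) (v s : ℝ) (y : Fin n → ℂ) :
    Measurable (densIntegrand ρ m v s y) := by
  have h : densIntegrand ρ m v s y = _ := funext (densIntegrand_eq ρ m v s y)
  rw [h]
  fun_prop

/-- Since `u` is a unit vector, it enters only through the last factor, whose exponent is linear, so
`lintegral_sphereLaw_exp` applies. -/
lemma exp_neg_mixture {n : ℕ} {v s E : ℝ} (hE : 0 ≤ E) (m z : ℂ)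
    {u : Fin n → ℂ} (hu : normSq u = 1) (y : Fin n → ℂ) :
    Real.exp (-(s * (‖z - m‖ ^ 2 / v + normSq (y - z • ((Real.sqrt E : ℂ) • u))))) =
      Real.exp (-(s * (‖m‖ ^ 2 / v + normSq y))) *
        (Real.exp (-(s * (E + v⁻¹) * ‖z‖ ^ 2)) *
          Real.exp (2 * (starRingEnd ℂ z * ((s / v : ℝ) * m)).re) *
            Real.exp (2 * (star ((starRingEnd ℂ z * (Real.sqrt E : ℂ) * (s : ℂ)) • y) ⬝ᵥ u).re)) := by
  rw [smul_smul, normSq_sub_smul, hu, ← Real.exp_add, ← Real.exp_add, ← Real.exp_add]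
  have h1 : ‖z * (Real.sqrt E : ℂ)‖ ^ 2 = ‖z‖ ^ 2 * E := by
    rw [norm_mul, mul_pow, Complex.norm_real, Real.norm_of_nonneg (Real.sqrt_nonneg _),
      Real.sq_sqrt hE]
  have h2 : ‖z - m‖ ^ 2 = ‖z‖ ^ 2 + ‖m‖ ^ 2 - 2 * (starRingEnd ℂ z * m).re := by
    simp only [← Complex.normSq_eq_norm_sq, Complex.normSq_apply, Complex.sub_re, Complex.sub_im,
      Complex.mul_re, Complex.conj_re, Complex.conj_im]
    ring
  have h3 : (star ((starRingEnd ℂ z * (Real.sqrt E : ℂ) * (s : ℂ)) • y) ⬝ᵥ u).re =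
      s * (starRingEnd ℂ (z * (Real.sqrt E : ℂ)) * (star u ⬝ᵥ y)).re := by
    rw [star_smul, smul_dotProduct, Matrix.star_dotProduct y u, smul_eq_mul, ← Complex.conj_re]
    simp only [map_mul, RCLike.star_def, Complex.conj_conj, Complex.conj_ofReal]
    rw [← Complex.re_ofReal_mul]
    congr 1
    ring
  have h4 : (starRingEnd ℂ z * ((s / v : ℝ) * m)).re = s / v * (starRingEnd ℂ z * m).re := by
    rw [← Complex.re_ofReal_mul]
    congr 1
    ring
  rw [h1, h2, h3, h4]
  congr 1
  ring

/-- With the metric written as a mixture, the average over `u` is taken first, then that over the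
phase of `z`; its squared modulus remains. The factor `s ^ (n - 1)` compensates the one in
`besselQuot_eq`. -/
lemma lintegral_sphereLaw_metric {n : ℕ} [NeZero n] {ρ v s : ℝ} (hρ : 0 ≤ ρ) (hv : 0 < v)
    (hs : 0 < s) (m : ℂ) (y : Fin n → ℂ) :
    ENNReal.ofReal (s ^ (n - 1)) * ∫⁻ u, ENNReal.ofReal (Real.exp (-(s *
        metricExp v m ((Real.sqrt (n * ρ) : ℂ) • u) y))) ∂(sphereLaw n) =
      ENNReal.ofReal (s * (v⁻¹ + n * ρ) * Real.exp (-(s * (‖m‖ ^ 2 / v + normSq y))) *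
        (n - 1).factorial) *
        ∫⁻ z in Set.Ioi (0 : ℝ), ENNReal.ofReal (densIntegrand ρ m v s y z) := by
  set E : ℝ := n * ρ
  have hE : 0 ≤ E := by positivity
  have hb : 0 < v⁻¹ + E := by positivity
  have hmeas : Measurable fun p : (Fin n → ℂ) × ℂ =>
      ENNReal.ofReal (Real.exp (-(s * (E + v⁻¹) * ‖p.2‖ ^ 2)) *
        Real.exp (2 * (starRingEnd ℂ p.2 * ((s / v : ℝ) * m)).re) *
        Real.exp (2 * (star ((starRingEnd ℂ p.2 * (Real.sqrt E : ℂ) * (s : ℂ)) • y) ⬝ᵥ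
          p.1).re)) := by
    have : Measurable fun p : (Fin n → ℂ) × ℂ =>
        star ((starRingEnd ℂ p.2 * (Real.sqrt E : ℂ) * (s : ℂ)) • y) ⬝ᵥ p.1 := by
      unfold dotProduct
      simp only [Pi.star_apply, Pi.smul_apply]
      fun_prop
    fun_prop
  have hinner : Measurable fun u : Fin n → ℂ => ∫⁻ z : ℂ,
      ENNReal.ofReal (Real.exp (-(s * (E + v⁻¹) * ‖z‖ ^ 2)) *
        Real.exp (2 * (starRingEnd ℂ z * ((s / v : ℝ) * m)).re) *
        Real.exp (2 * (star ((starRingEnd ℂ z * (Real.sqrt E : ℂ) * (s : ℂ)) • y) ⬝ᵥ u).re)) :=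
    Measurable.lintegral_prod_right' hmeas
  have hmz : ∀ u : Fin n → ℂ, Measurable fun z : ℂ =>
      ENNReal.ofReal (Real.exp (-(s * (E + v⁻¹) * ‖z‖ ^ 2)) *
        Real.exp (2 * (starRingEnd ℂ z * ((s / v : ℝ) * m)).re) *
        Real.exp (2 * (star ((starRingEnd ℂ z * (Real.sqrt E : ℂ) * (s : ℂ)) • y) ⬝ᵥ u).re)) := by
    intro u
    have h := hmeas.comp (measurable_prodMk_left (x := u))
    exact h
  have h1 : ∀ᵐ u ∂(sphereLaw n), ENNReal.ofReal (Real.exp (-(s *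
      metricExp v m ((Real.sqrt E : ℂ) • u) y))) = ENNReal.ofReal (s * (v⁻¹ + E) / Real.pi) *
        (ENNReal.ofReal (Real.exp (-(s * (‖m‖ ^ 2 / v + normSq y)))) * ∫⁻ z : ℂ,
          ENNReal.ofReal (Real.exp (-(s * (E + v⁻¹) * ‖z‖ ^ 2)) *
          Real.exp (2 * (starRingEnd ℂ z * ((s / v : ℝ) * m)).re) *
          Real.exp (2 * (star ((starRingEnd ℂ z * (Real.sqrt E : ℂ) * (s : ℂ)) • y) ⬝ᵥ u).re))) := by
    filter_upwards [ae_normSq_sphereLaw n] with u hu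
    rw [← lintegral_const_mul _ (hmz u)]
    simp_rw [← ENNReal.ofReal_mul (Real.exp_pos _).le, ← exp_neg_mixture hE m _ hu y]
    rw [lintegral_gaussian_mixture hv hs, ← ENNReal.ofReal_mul (by positivity), normSq_smul, hu,
      Complex.norm_real, Real.norm_of_nonneg (Real.sqrt_nonneg _), Real.sq_sqrt hE, mul_one]
    congr 1
    field_simp
  rw [lintegral_congr_ae h1]
  rw [lintegral_const_mul _ (hinner.const_mul _), lintegral_const_mul _ hinner,
    lintegral_lintegral_swap hmeas.aemeasurable]
  have h2 : ∀ z : ℂ, ∫⁻ u, ENNReal.ofReal (Real.exp (-(s * (E + v⁻¹) * ‖z‖ ^ 2)) *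
        Real.exp (2 * (starRingEnd ℂ z * ((s / v : ℝ) * m)).re) *
        Real.exp (2 * (star ((starRingEnd ℂ z * (Real.sqrt E : ℂ) * (s : ℂ)) • y) ⬝ᵥ u).re))
          ∂(sphereLaw n) =
      (fun t => ENNReal.ofReal (Real.exp (-(s * (E + v⁻¹) * t)) * ((n - 1).factorial *
        besselSeries (n - 1) (s * (Real.sqrt (normSq y) * Real.sqrt (E * t)))))) (‖z‖ ^ 2) *
      ENNReal.ofReal (Real.exp (2 * (starRingEnd ℂ z * ((s / v : ℝ) * m)).re)) := by
    intro z
    simp_rw [fun u : Fin n → ℂ => ENNReal.ofReal_mul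
      (p := Real.exp (-(s * (E + v⁻¹) * ‖z‖ ^ 2)) *
        Real.exp (2 * (starRingEnd ℂ z * ((s / v : ℝ) * m)).re))
      (q := Real.exp (2 * (star ((starRingEnd ℂ z * (Real.sqrt E : ℂ) * (s : ℂ)) • y) ⬝ᵥ u).re))
      (by positivity)]
    rw [lintegral_const_mul _ (by fun_prop), lintegral_sphereLaw_exp,
      ENNReal.ofReal_mul (Real.exp_pos _).le, ENNReal.ofReal_mul (Real.exp_pos _).le]
    have h3 : Real.sqrt (normSq ((starRingEnd ℂ z * (Real.sqrt E : ℂ) * (s : ℂ)) • y)) =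
        s * (Real.sqrt (normSq y) * Real.sqrt (E * ‖z‖ ^ 2)) := by
      rw [normSq_smul, Real.sqrt_mul (by positivity), Real.sqrt_sq (norm_nonneg _), norm_mul,
        norm_mul, RCLike.norm_conj, Complex.norm_real, Complex.norm_real,
        Real.norm_of_nonneg (Real.sqrt_nonneg _), Real.norm_of_nonneg hs.le, Real.sqrt_mul hE,
        Real.sqrt_sq (norm_nonneg _)]
      ring
    rw [h3]
    ring
  simp_rw [h2]
  rw [lintegral_radial_mul_exp (G := fun t => ENNReal.ofReal (Real.exp (-(s * (E + v⁻¹) * t)) *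
    ((n - 1).factorial * besselSeries (n - 1) (s * (Real.sqrt (normSq y) * Real.sqrt (E * t))))))
    (by fun_prop)]
  have h4 : ∀ t ∈ Set.Ioi (0 : ℝ), ENNReal.ofReal (densIntegrand ρ m v s y t) =
      ENNReal.ofReal (s ^ (n - 1) / (n - 1).factorial) * (ENNReal.ofReal
        (Real.exp (-(s * (E + v⁻¹) * t)) * ((n - 1).factorial *
        besselSeries (n - 1) (s * (Real.sqrt (normSq y) * Real.sqrt (E * t))))) *
          ENNReal.ofReal (besselSeries 0 (Real.sqrt t * ‖((s / v : ℝ) : ℂ) * m‖))) := by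
    intro t ht
    have ht' : 0 < t := ht
    have hB1 := besselSeries_nonneg (n - 1) (s * (Real.sqrt (normSq y) * Real.sqrt (E * t)))
    rw [← ENNReal.ofReal_mul (by positivity), ← ENNReal.ofReal_mul (by positivity),
      densIntegrand_eq]
    congr 1
    have h5 : s * v⁻¹ * Real.sqrt (t * ‖m‖ ^ 2) = Real.sqrt t * ‖((s / v : ℝ) : ℂ) * m‖ := by
      rw [Real.sqrt_mul ht'.le, Real.sqrt_sq (norm_nonneg _), norm_mul, Complex.norm_real,
        Real.norm_of_nonneg (by positivity)]
      ring
    have h6 : ρ * n = E := mul_comm _ _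
    have h7 : ((n - 1).factorial : ℝ) ≠ 0 := by exact_mod_cast (n - 1).factorial_ne_zero
    rw [h5, h6]
    field_simp
  rw [setLIntegral_congr_fun measurableSet_Ioi h4, lintegral_const_mul _ (by fun_prop)]
  simp only [← mul_assoc]
  congr 1
  have h7 : ((n - 1).factorial : ℝ) ≠ 0 := by exact_mod_cast (n - 1).factorial_ne_zero
  rw [← ENNReal.ofReal_mul (by positivity), ← ENNReal.ofReal_mul (by positivity),
    ← ENNReal.ofReal_mul (by positivity), ← ENNReal.ofReal_mul (by positivity)]
  congr 1
  field_simp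

lemma lintegral_sphereLaw_metric_pos {n : ℕ} {v s : ℝ} (m r : ℂ) (y : Fin n → ℂ) :
    0 < ∫⁻ u, ENNReal.ofReal (Real.exp (-(s * metricExp v m (r • u) y))) ∂(sphereLaw n) := by
  have hm : Measurable fun u : Fin n → ℂ =>
      ENNReal.ofReal (Real.exp (-(s * metricExp v m (r • u) y))) := by
    have := measurable_metricExp_comp (v := v) (measurable_const (a := m))
      (by fun_prop : Measurable fun u : Fin n → ℂ => r • u) (measurable_const (a := y))
    fun_prop
  rw [lintegral_pos_iff_support hm]
  have h : Function.support (fun u : Fin n → ℂ =>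
      ENNReal.ofReal (Real.exp (-(s * metricExp v m (r • u) y)))) = Set.univ := by
    ext u
    simp [Real.exp_pos]
  rw [h, measure_univ]
  exact one_pos

lemma lintegral_sphereLaw_metric_le_one {n : ℕ} {v s : ℝ} (hv : 0 < v) (hs : 0 < s) (m r : ℂ)
    (y : Fin n → ℂ) :
    ∫⁻ u, ENNReal.ofReal (Real.exp (-(s * metricExp v m (r • u) y))) ∂(sphereLaw n) ≤ 1 := by
  refine (lintegral_mono (g := fun _ => 1) fun u => ?_).trans (by simp)
  have := metricExp_nonneg hv m (r • u) y
  simp only [ENNReal.ofReal_le_one, Real.exp_le_one_iff, Left.neg_nonpos_iff]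
  positivity

/-- The ratio of the mean of the `s`-th power of the metric of a random codeword of energy `E` to
the `s`-th power of the metric of the codeword `x`. -/
def metricRatio {n : ℕ} (E s v : ℝ) (m : ℂ) (x y : Fin n → ℂ) : ℝ≥0∞ :=
  ∫⁻ u, ENNReal.ofReal (Real.exp (s * (metricExp v m x y -
    metricExp v m ((Real.sqrt E : ℂ) • u) y))) ∂(sphereLaw n)

/-- `wTilde` undoes the whitening implicit in the metric: the excess `v E |w₀|²` in the norm is
exactly the projection term that is subtracted. -/
lemma metricExp_wTilde {n : ℕ} [NeZero n] {ρ v : ℝ} (hρ : 0 ≤ ρ) (hv : 0 < v) (m : ℂ)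
    (w : Fin n → ℂ) :
    metricExp v m (Pi.single (0 : Fin n) (Real.sqrt (n * ρ) : ℂ)) (wTilde ρ m v w) = normSq w := by
  set E : ℝ := n * ρ
  have hE : 0 ≤ E := by positivity
  have hvE : 0 < 1 + v * E := by positivity
  have hu : wTilde ρ m v w - m • Pi.single (0 : Fin n) (Real.sqrt E : ℂ) =
      fun i => if i = 0 then (Real.sqrt (1 + v * E) : ℂ) * w i else w i := by
    funext i
    by_cases hi : i = 0
    · subst hi
      have h1 : v * n * ρ + 1 = 1 + v * E := by simp only [E]; ring
      simp [wTilde, h1, E]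
    · have h2 : i.val ≠ 0 := fun h => hi (Fin.ext (by simpa using h))
      simp [wTilde, h2, hi]
  unfold metricExp
  rw [hu, normSq_single, Complex.norm_real, Real.norm_of_nonneg (Real.sqrt_nonneg _),
    Real.sq_sqrt hE, Pi.star_single, single_dotProduct]
  have h3 : normSq (fun i => if i = 0 then (Real.sqrt (1 + v * E) : ℂ) * w i else w i) =
      normSq w + v * E * ‖w 0‖ ^ 2 := by
    unfold normSq
    rw [Fintype.sum_eq_add_sum_compl (0 : Fin n), Fintype.sum_eq_add_sum_compl (0 : Fin n)
      (fun i => ‖w i‖ ^ 2)]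
    have h4 : ∀ i ∈ ({0}ᶜ : Finset (Fin n)),
        ‖(if i = 0 then (Real.sqrt (1 + v * E) : ℂ) * w i else w i)‖ ^ 2 = ‖w i‖ ^ 2 := by
      intro i hi
      rw [if_neg (by simpa using hi)]
    rw [Finset.sum_congr rfl h4]
    simp only [if_true]
    rw [norm_mul, mul_pow, Complex.norm_real,
      Real.norm_of_nonneg (Real.sqrt_nonneg _), Real.sq_sqrt hvE.le]
    ring
  rw [h3, if_pos rfl, norm_mul, norm_mul, norm_star, Complex.norm_real, Complex.norm_real,
    Real.norm_of_nonneg (Real.sqrt_nonneg _), Real.norm_of_nonneg (Real.sqrt_nonneg _), mul_pow,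
    mul_pow, Real.sq_sqrt hE, Real.sq_sqrt hvE.le]
  field_simp
  ring

lemma ofReal_exp_neg_infoDens {n : ℕ} [NeZero n] {ρ v s : ℝ} (hρ : 0 ≤ ρ) (hv : 0 < v)
    (hs : 0 ≤ s) (m : ℂ) (w : Fin n → ℂ) :
    ENNReal.ofReal (Real.exp (-infoDens ρ m v s w)) =
      metricRatio (n * ρ) s v m (Pi.single (0 : Fin n) (Real.sqrt (n * ρ) : ℂ))
        (wTilde ρ m v w) := by
  unfold metricRatio
  rw [metricExp_wTilde hρ hv]
  -- At `s = 0` both sides equal one, by the convention in `infoDens`.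
  rcases hs.eq_or_lt with rfl | hs
  · simp [infoDens]
  set y := wTilde ρ m v w
  set E : ℝ := n * ρ
  have hE : 0 ≤ E := by positivity
  have hmain := lintegral_sphereLaw_metric hρ hv hs m y
  have hpos := lintegral_sphereLaw_metric_pos (v := v) (s := s) m (Real.sqrt (n * ρ) : ℂ) y
  have hle := lintegral_sphereLaw_metric_le_one hv hs m (Real.sqrt (n * ρ) : ℂ) y
  set A := ∫⁻ u, ENNReal.ofReal (Real.exp (-(s * metricExp v m ((Real.sqrt E : ℂ) • u) y)))
    ∂(sphereLaw n)
  set C : ℝ := s * (v⁻¹ + E) * Real.exp (-(s * (‖m‖ ^ 2 / v + normSq y))) * (n - 1).factorial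
  have hf : (0 : ℝ) < (n - 1).factorial := by exact_mod_cast (n - 1).factorial_pos
  have hC : 0 < C := by positivity
  set J : ℝ := ∫ z in Set.Ioi (0 : ℝ), densIntegrand ρ m v s y z
  have hJ : (∫⁻ z in Set.Ioi (0 : ℝ), ENNReal.ofReal (densIntegrand ρ m v s y z)).toReal = J :=
    (integral_eq_lintegral_of_nonneg_ae
      (Filter.Eventually.of_forall (densIntegrand_nonneg ρ m hs.le y))
      (measurable_densIntegrand ρ m v s y).aestronglyMeasurable).symm
  have hreal := congrArg ENNReal.toReal hmain
  rw [ENNReal.toReal_mul, ENNReal.toReal_mul, hJ, ENNReal.toReal_ofReal (by positivity),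
    ENNReal.toReal_ofReal hC.le] at hreal
  have hAtop : A ≠ ⊤ := ne_top_of_le_ne_top ENNReal.one_ne_top hle
  have hA0 : 0 < A.toReal := ENNReal.toReal_pos hpos.ne' hAtop
  -- This also excludes a divergent integral, whose value would be read as `0`, so the logarithm of
  -- `J` is genuine.
  have hJ0 : 0 < J := by
    have : 0 < C * J := by rw [← hreal]; positivity
    exact pos_of_mul_pos_right this hC.le
  have hAJ : A.toReal = C * J / s ^ (n - 1) := by
    rw [← hreal]
    field_simp
  have hR : ∫⁻ u, ENNReal.ofReal (Real.exp (s * (normSq w -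
      metricExp v m ((Real.sqrt E : ℂ) • u) y))) ∂(sphereLaw n) =
      ENNReal.ofReal (Real.exp (s * normSq w) * A.toReal) := by
    rw [ENNReal.ofReal_mul (Real.exp_pos _).le, ENNReal.ofReal_toReal hAtop,
      ← lintegral_const_mul' _ _ ENNReal.ofReal_ne_top]
    refine lintegral_congr fun u => ?_
    rw [← ENNReal.ofReal_mul (Real.exp_pos _).le, ← Real.exp_add]
    congr 2
    ring
  rw [hR, hAJ]
  congr 1
  have hn : 0 < n := Nat.pos_of_neZero n
  have hcast : ((n - 1 : ℕ) : ℝ) = n - 1 := by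
    rw [Nat.cast_sub hn, Nat.cast_one]
  have hG : Real.Gamma n = (n - 1).factorial := by
    have := Real.Gamma_nat_eq_factorial (n - 1)
    rw [hcast, sub_add_cancel] at this
    exact this
  have hID : infoDens ρ m v s w = ((n : ℝ) - 2) * Real.log s - Real.log ((1 + v * n * ρ) / v)
      - Real.log (Real.Gamma n) - s * (normSq w - normSq y) + s * ‖m‖ ^ 2 / v
      - Real.log J := by
    unfold infoDens
    rw [if_neg hs.ne']
    rfl
  have hvE : 0 < (1 + v * n * ρ) / v := by positivity
  have hlog : Real.log (Real.exp (s * normSq w) * (C * J / s ^ (n - 1))) =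
      -infoDens ρ m v s w := by
    have hvE' : v⁻¹ + E = (1 + v * n * ρ) / v := by
      simp only [E]
      field_simp
    rw [hID, Real.log_mul (Real.exp_pos _).ne' (by positivity), Real.log_exp,
      Real.log_div (by positivity) (by positivity), Real.log_mul hC.ne' hJ0.ne', Real.log_pow,
      hcast, hG]
    simp only [C]
    rw [hvE', Real.log_mul (by positivity) hf.ne', Real.log_mul (by positivity) (by positivity),
      Real.log_mul hs.ne' hvE.ne', Real.log_exp]
    ring
  rw [← hlog, Real.exp_log (by positivity)]

/-! ### The law of the information density -/

lemma noiseLaw_succ (k : ℕ) : noiseLaw (k + 1) = ((cgauss 0 1).prod (noiseLaw k)).map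
    fun p => (Fin.cons p.1 p.2 : Fin (k + 1) → ℂ) :=
  ((measurePreserving_piFinSuccAbove (fun _ : Fin (k + 1) => cgauss 0 1) 0).symm).map_eq.symm.trans
    (congrArg (fun f => Measure.map f ((cgauss 0 1).prod (noiseLaw k))) (funext fun p => by
      simp only [MeasurableEquiv.piFinSuccAbove_symm_apply, Fin.insertNthEquiv, Equiv.coe_fn_mk,
        Fin.insertNth_zero]
      rfl))

lemma cgauss_prod_map_affine (m : ℂ) {v : ℝ} (hv : 0 ≤ v) (r : ℝ) :
    ((cgauss m v).prod (cgauss 0 1)).map (fun p => p.1 * (r : ℂ) + p.2) =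
      cgauss (m * r) (v * r ^ 2 + 1) := by
  -- The centred sum is `star x ⬝ᵥ g` for a standard Gaussian vector `g`, so its variance is `normSq
  -- x`.
  let x : Fin 2 → ℂ := ![((Real.sqrt v * r : ℝ) : ℂ), 1]
  have hx : normSq x = v * r ^ 2 + 1 := by
    simp only [normSq, x, Fin.sum_univ_two, Matrix.cons_val_zero, Matrix.cons_val_one,
      Complex.norm_real, Real.norm_eq_abs, sq_abs, mul_pow, Real.sq_sqrt hv]
    simp
  have hdot : Measurable fun g : Fin 2 → ℂ => star x ⬝ᵥ g := by fun_prop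
  rw [cgauss_prod_cgauss m 0 hv zero_le_one, Measure.map_map (by fun_prop) (by fun_prop), ← hx,
    cgauss_eq_map _ (normSq_nonneg x)]
  have h : (fun p : ℂ × ℂ => p.1 * (r : ℂ) + p.2) ∘ (fun g : Fin 2 → ℂ =>
      (m + (Real.sqrt v : ℂ) * g 0, 0 + (Real.sqrt 1 : ℂ) * g 1)) =
      (fun z => m * r + z) ∘ fun g => star x ⬝ᵥ g := by
    funext g
    simp [x, dotProduct, Fin.sum_univ_two]
    ring
  rw [h, ← Measure.map_map (by fun_prop) hdot, noiseLaw_map_dotProduct,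
    cgauss_eq_map 0 (normSq_nonneg x), Measure.map_map (by fun_prop) (by fun_prop)]
  simp [Function.comp_def]

lemma measurable_wTilde {n : ℕ} (ρ : ℝ) (v : ℝ) :
    Measurable fun p : ℂ × (Fin n → ℂ) => wTilde ρ p.1 v p.2 := by
  refine measurable_pi_lambda _ fun i => ?_
  unfold wTilde
  split_ifs <;> fun_prop

lemma measurable_fin_cons (k : ℕ) :
    Measurable fun p : ℂ × (Fin k → ℂ) => (Fin.cons p.1 p.2 : Fin (k + 1) → ℂ) := by
  refine measurable_pi_lambda _ fun i => ?_
  refine Fin.cases ?_ (fun j => ?_) i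
  · simp only [Fin.cons_zero]; fun_prop
  · simp only [Fin.cons_succ]; fun_prop

/-- Only the first coordinate sees the fading; there fading plus noise is a single Gaussian,
represented in law by rescaling and shifting `w 0`. -/
lemma fadingLaw_single {n : ℕ} [NeZero n] {ρ v : ℝ} (hρ : 0 ≤ ρ) (hv : 0 ≤ v) (m : ℂ) :
    fadingLaw m v (Pi.single (0 : Fin n) (Real.sqrt (n * ρ) : ℂ)) =
      (noiseLaw n).map (wTilde ρ m v) := by
  obtain ⟨k, rfl⟩ := Nat.exists_eq_succ_of_ne_zero (NeZero.ne n)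
  have hE : 0 ≤ ((k + 1 : ℕ) : ℝ) * ρ := by positivity
  set r : ℝ := Real.sqrt (((k + 1 : ℕ) : ℝ) * ρ)
  have hcons := measurable_fin_cons k
  have hwt : Measurable (wTilde ρ m v : (Fin (k + 1) → ℂ) → _) :=
    (measurable_wTilde ρ v).comp measurable_prodMk_left
  have hid : noiseLaw k = (noiseLaw k).map id := Measure.map_id.symm
  have hsum : Measurable fun p : ℂ × ℂ => p.1 * (r : ℂ) + p.2 := by fun_prop
  have haff : Measurable fun z : ℂ => m * r + (Real.sqrt (v * r ^ 2 + 1) : ℂ) * z := by fun_prop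
  have hr : v * r ^ 2 = v * ((k + 1 : ℕ) : ℝ) * ρ := by
    simp only [r]
    rw [Real.sq_sqrt hE]
    ring
  have hR : (noiseLaw (k + 1)).map (wTilde ρ m v) =
      ((cgauss (m * r) (v * r ^ 2 + 1)).prod (noiseLaw k)).map
        fun p => (Fin.cons p.1 p.2 : Fin (k + 1) → ℂ) := by
    rw [noiseLaw_succ, Measure.map_map hwt hcons, cgauss_eq_map (m * r) (by positivity)]
    conv_rhs => rw [hid]
    rw [Measure.map_prod_map _ _ haff measurable_id,
      Measure.map_map hcons (haff.prodMap measurable_id)]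
    congr 1
    funext p i
    refine Fin.cases ?_ (fun j => ?_) i
    · change m * (r : ℂ) + (Real.sqrt (v * ((k + 1 : ℕ) : ℝ) * ρ + 1) : ℂ) * p.1 =
        m * r + (Real.sqrt (v * r ^ 2 + 1) : ℂ) * p.1
      rw [hr]
    · simp [wTilde]
  have hLm : Measurable fun ω : ℂ × (Fin (k + 1) → ℂ) => (fun i => ω.1 *
      (Pi.single (0 : Fin (k + 1)) (r : ℂ) : Fin (k + 1) → ℂ) i + ω.2 i : Fin (k + 1) → ℂ) := by
    fun_prop
  have hidm : cgauss m v = (cgauss m v).map id := Measure.map_id.symm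
  have hassoc := (measurePreserving_prodAssoc (cgauss m v) (cgauss 0 1) (noiseLaw k)).map_eq
  rw [hR, ← cgauss_prod_map_affine m hv r]
  conv_rhs => rw [hid]
  rw [Measure.map_prod_map _ _ hsum measurable_id,
    Measure.map_map hcons (hsum.prodMap measurable_id)]
  unfold fadingLaw
  rw [noiseLaw_succ]
  conv_lhs => rw [hidm]
  rw [Measure.map_prod_map _ _ measurable_id hcons,
    Measure.map_map hLm (measurable_id.prodMap hcons), ← hassoc,
    Measure.map_map (hLm.comp (measurable_id.prodMap hcons)) (MeasurableEquiv.measurable _)]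
  congr 1
  funext p i
  refine Fin.cases ?_ (fun j => ?_) i
  · simp [MeasurableEquiv.prodAssoc]
  · simp [MeasurableEquiv.prodAssoc, Fin.succ_ne_zero]

lemma IsUnitaryMap.fadingLaw_map {n : ℕ} {L : (Fin n → ℂ) →ₗ[ℂ] (Fin n → ℂ)}
    (hL : IsUnitaryMap L) (m : ℂ) (v : ℝ) (x : Fin n → ℂ) :
    (fadingLaw m v x).map L = fadingLaw m v (L x) := by
  unfold fadingLaw
  have hidm : cgauss m v = (cgauss m v).map id := Measure.map_id.symm
  have hLm := IsUnitaryMap.measurable L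
  conv_rhs => rw [← hL.map_noiseLaw, hidm]
  rw [Measure.map_prod_map _ _ measurable_id hLm, Measure.map_map hLm (by fun_prop),
    Measure.map_map (by fun_prop) (measurable_id.prodMap hLm)]
  congr 1
  funext ω
  change L (ω.1 • x + ω.2) = ω.1 • L x + L ω.2
  rw [map_add, map_smul]

/-- The averaged competitor is uniform on a sphere, so it absorbs the rotation. -/
lemma IsUnitaryMap.metricRatio_apply {n : ℕ} {L : (Fin n → ℂ) →ₗ[ℂ] (Fin n → ℂ)}
    (hL : IsUnitaryMap L) (E s v : ℝ) (m : ℂ) (x y : Fin n → ℂ) :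
    metricRatio E s v m (L x) (L y) = metricRatio E s v m x y := by
  unfold metricRatio
  have hm : Measurable fun u : Fin n → ℂ => ENNReal.ofReal (Real.exp (s *
      (metricExp v m (L x) (L y) - metricExp v m ((Real.sqrt E : ℂ) • u) (L y)))) := by
    have := measurable_metricExp_comp (v := v) (measurable_const (a := m))
      (by fun_prop : Measurable fun u : Fin n → ℂ => (Real.sqrt E : ℂ) • u)
      (measurable_const (a := L y))
    fun_prop
  rw [← hL.lintegral_sphereLaw hm]
  simp_rw [← L.map_smul, hL.metricExp_apply]

lemma measurable_metricRatio {n : ℕ} (E s v : ℝ) (x : Fin n → ℂ) :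
    Measurable fun p : ℂ × (Fin n → ℂ) => metricRatio E s v p.1 x p.2 := by
  unfold metricRatio
  refine Measurable.lintegral_prod_right' (f := fun q : (ℂ × (Fin n → ℂ)) × (Fin n → ℂ) =>
    ENNReal.ofReal (Real.exp (s * (metricExp v q.1.1 x q.1.2 -
      metricExp v q.1.1 ((Real.sqrt E : ℂ) • q.2) q.1.2)))) ?_
  have h1 := measurable_metricExp_comp (v := v)
    (by fun_prop : Measurable fun q : (ℂ × (Fin n → ℂ)) × (Fin n → ℂ) => q.1.1)
    (measurable_const (a := x)) (by fun_prop : Measurable fun q :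
      (ℂ × (Fin n → ℂ)) × (Fin n → ℂ) => q.1.2)
  have h2 := measurable_metricExp_comp (v := v)
    (by fun_prop : Measurable fun q : (ℂ × (Fin n → ℂ)) × (Fin n → ℂ) => q.1.1)
    (by fun_prop : Measurable fun q : (ℂ × (Fin n → ℂ)) × (Fin n → ℂ) => (Real.sqrt E : ℂ) • q.2)
    (by fun_prop : Measurable fun q : (ℂ × (Fin n → ℂ)) × (Fin n → ℂ) => q.1.2)
  fun_prop

/-- The metric ratio of the transmitted codeword has the law of `exp (-S)`, where `S` is the
information density. -/
lemma fadingLaw_map_metricRatio {n : ℕ} [NeZero n] {ρ v s : ℝ} (hρ : 0 ≤ ρ) (hv : 0 < v)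
    (hs : 0 ≤ s) (m : ℂ) {x : Fin n → ℂ} (hx : normSq x = n * ρ) :
    (fadingLaw m v x).map (metricRatio (n * ρ) s v m x) =
      (noiseLaw n).map fun w => ENNReal.ofReal (Real.exp (-infoDens ρ m v s w)) := by
  have hE : 0 ≤ (n : ℝ) * ρ := by positivity
  set x₀ : Fin n → ℂ := Pi.single (0 : Fin n) (Real.sqrt (n * ρ) : ℂ)
  obtain ⟨L, hL, hLx⟩ := exists_isUnitaryMap_apply_eq (x := x₀) (y := x) (by
    rw [hx, normSq_single, Complex.norm_real, Real.norm_of_nonneg (Real.sqrt_nonneg _),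
      Real.sq_sqrt hE])
  have hmr : Measurable (metricRatio (n * ρ) s v m x) := by
    have h := (measurable_metricRatio (n * ρ) s v x).comp (measurable_prodMk_left (x := m))
    exact h
  have hwt : Measurable (wTilde ρ m v : (Fin n → ℂ) → _) :=
    (measurable_wTilde ρ v).comp measurable_prodMk_left
  have hLm := IsUnitaryMap.measurable L
  conv_lhs => rw [← hLx]
  rw [← hL.fadingLaw_map, fadingLaw_single hρ hv.le, Measure.map_map hLm hwt, hLx,
    Measure.map_map hmr (hLm.comp hwt)]
  congr 1
  funext w
  simp only [Function.comp]
  rw [ofReal_exp_neg_infoDens hρ hv hs, ← hL.metricRatio_apply _ _ _ _ x₀, hLx]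

/-! ### Random coding -/

/-- The random-coding union bound: if the pairwise error bound of a random codeword is at most `B`
for almost every transmitted codeword, then so is the mean error probability of a random code. -/
lemma random_coding_union_bound {𝒳 Ω 𝒪 : Type*} [MeasurableSpace 𝒳] [MeasurableSpace Ω]
    [MeasurableSpace 𝒪] (P : Measure Ω) [IsProbabilityMeasure P] (Q : Measure 𝒳)
    [IsProbabilityMeasure Q] {out : 𝒳 × Ω → 𝒪} (hout : Measurable out) {D : 𝒳 × 𝒪 → ℝ}
    (hD : Measurable D) {M : ℕ} {B : ℝ≥0∞}
    (hB : ∀ᵐ x ∂Q, ∫⁻ ω, min 1 ((M : ℝ≥0∞) *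
      Q {x' | D (x, out (x, ω)) ≤ D (x', out (x, ω))}) ∂P ≤ B) (j : Fin (M + 1)) :
    ∫⁻ c, P {ω | ∃ i, i ≠ j ∧ D (c j, out (c j, ω)) ≤ D (c i, out (c j, ω))}
      ∂(Measure.pi fun _ : Fin (M + 1) => Q) ≤ B := by
  have hle : ∀ i : Fin M, MeasurableSet {q : (𝒳 × (Fin M → 𝒳)) × Ω |
      D (q.1.1, out (q.1.1, q.2)) ≤ D (q.1.2 i, out (q.1.1, q.2))} := fun i =>
    measurableSet_le (by fun_prop) (by fun_prop)
  have hS : MeasurableSet {q : (𝒳 × (Fin M → 𝒳)) × Ω |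
      ∃ i, D (q.1.1, out (q.1.1, q.2)) ≤ D (q.1.2 i, out (q.1.1, q.2))} := by
    rw [Set.ofPred_exists]
    exact MeasurableSet.iUnion hle
  set S := {q : (𝒳 × (Fin M → 𝒳)) × Ω |
      ∃ i, D (q.1.1, out (q.1.1, q.2)) ≤ D (q.1.2 i, out (q.1.1, q.2))}
  -- Splits off the sent codeword; the `M` competitors remain independent of it.
  have hmp := measurePreserving_piFinSuccAbove (fun _ : Fin (M + 1) => Q) j
  have h1 : ∀ c : Fin (M + 1) → 𝒳,
      P {ω | ∃ i, i ≠ j ∧ D (c j, out (c j, ω)) ≤ D (c i, out (c j, ω))} =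
        P (Prod.mk (MeasurableEquiv.piFinSuccAbove (fun _ => 𝒳) j c) ⁻¹' S) := by
    intro c
    congr 1
    ext ω
    simp only [S, Set.mem_ofPred_eq, Set.mem_preimage]
    constructor
    · rintro ⟨i, hi, h⟩
      obtain ⟨k, rfl⟩ := Fin.exists_succAbove_eq hi
      exact ⟨k, h⟩
    · rintro ⟨k, h⟩
      exact ⟨j.succAbove k, Fin.succAbove_ne j k, h⟩
  simp_rw [h1]
  have hmS : Measurable fun p : 𝒳 × (Fin M → 𝒳) => P (Prod.mk p ⁻¹' S) :=
    measurable_measure_prodMk_left hS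
  rw [hmp.lintegral_comp hmS, lintegral_prod _ hmS.aemeasurable]
  have h2 : ∀ᵐ x ∂Q, ∫⁻ c', P (Prod.mk (x, c') ⁻¹' S) ∂(Measure.pi fun _ : Fin M => Q) ≤ B := by
    filter_upwards [hB] with x hx
    refine le_trans ?_ hx
    have hSx : MeasurableSet {q : (Fin M → 𝒳) × Ω | ((x, q.1), q.2) ∈ S} := by
      have : Measurable fun q : (Fin M → 𝒳) × Ω => ((x, q.1), q.2) := by fun_prop
      exact this hS
    have h3 : ∫⁻ c', P (Prod.mk (x, c') ⁻¹' S) ∂(Measure.pi fun _ : Fin M => Q) =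
        ((Measure.pi fun _ : Fin M => Q).prod P) {q | ((x, q.1), q.2) ∈ S} :=
      (Measure.prod_apply hSx).symm
    -- The competitors are averaged inside, with the channel realization fixed, so that the
    -- truncation at one acts for each realization separately.
    rw [h3, Measure.prod_apply_symm hSx]
    refine lintegral_mono fun ω => ?_
    refine le_min prob_le_one ?_
    have h4 : (fun c' : Fin M → 𝒳 => (c', ω)) ⁻¹' {q | ((x, q.1), q.2) ∈ S} ⊆
        ⋃ i : Fin M, {c' : Fin M → 𝒳 | D (x, out (x, ω)) ≤ D (c' i, out (x, ω))} := by
      rintro c' ⟨i, hi⟩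
      exact Set.mem_iUnion.2 ⟨i, hi⟩
    refine (measure_mono h4).trans ((measure_iUnion_fintype_le _ _).trans ?_)
    have hset : MeasurableSet {x' | D (x, out (x, ω)) ≤ D (x', out (x, ω))} :=
      measurableSet_le measurable_const (by fun_prop)
    have h5 : ∀ i : Fin M, (Measure.pi fun _ : Fin M => Q)
        {c' : Fin M → 𝒳 | D (x, out (x, ω)) ≤ D (c' i, out (x, ω))} =
        Q {x' | D (x, out (x, ω)) ≤ D (x', out (x, ω))} := fun i =>
      (measurePreserving_eval (fun _ : Fin M => Q) i).measure_preimage hset.nullMeasurableSet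
    simp_rw [h5]
    simp
  exact (lintegral_mono_ae h2).trans (by simp)

/-- Measurable functions `g i`, `i : Fin M`, have a measurable choice of a maximizing index. -/
lemma exists_measurable_argmax {𝒪 : Type*} [MeasurableSpace 𝒪] {M : ℕ} (hM : 0 < M)
    {g : Fin M → 𝒪 → ℝ} (hg : ∀ i, Measurable (g i)) :
    ∃ d : 𝒪 → Fin M, Measurable d ∧ ∀ y i, g i y ≤ g (d y) y := by
  classical
  have hne : ∀ y, (Finset.univ.filter fun i => ∀ k, g k y ≤ g i y).Nonempty := by
    intro y
    obtain ⟨i, -, hi⟩ := Finset.exists_max_image Finset.univ (fun i => g i y) ⟨⟨0, hM⟩, by simp⟩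
    exact ⟨i, by simpa using hi⟩
  -- Ties go to the smallest index, which makes the decision regions finite Boolean combinations of
  -- comparisons.
  refine ⟨fun y => (Finset.univ.filter fun i => ∀ k, g k y ≤ g i y).min' (hne y), ?_, ?_⟩
  · refine measurable_to_countable' fun i => ?_
    have h : (fun y => (Finset.univ.filter fun i => ∀ k, g k y ≤ g i y).min' (hne y)) ⁻¹' {i} =
        {y | (∀ k, g k y ≤ g i y) ∧ ∀ l, l < i → ¬ ∀ k, g k y ≤ g l y} := by
      ext y
      simp only [Set.mem_preimage, Set.mem_singleton_iff, Set.mem_ofPred_eq, Finset.min'_eq_iff,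
        Finset.mem_filter, Finset.mem_univ, true_and]
      refine and_congr_right fun _ => ⟨fun H l hl hk => absurd (H l hk) (not_le.2 hl),
        fun H l hk => le_of_not_gt fun hl => H l hl hk⟩
    rw [h]
    have hmax : ∀ l, MeasurableSet {y | ∀ k, g k y ≤ g l y} := fun l => by
      rw [Set.ofPred_forall]
      exact MeasurableSet.iInter fun k => measurableSet_le (hg k) (hg l)
    refine (hmax i).inter ?_
    have h2 : {y | ∀ l, l < i → ¬ ∀ k, g k y ≤ g l y} =
        ⋂ l, ⋂ _ : l < i, {y | ∀ k, g k y ≤ g l y}ᶜ := by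
      ext y
      simp
    change MeasurableSet {y | ∀ l, l < i → ¬ ∀ k, g k y ≤ g l y}
    rw [h2]
    exact MeasurableSet.iInter fun l => MeasurableSet.iInter fun _ => (hmax l).compl
  · intro y i
    have := Finset.min'_mem _ (hne y)
    simp only [Finset.mem_filter, Finset.mem_univ, true_and] at this
    exact this i

/-! ### Random codewords -/

/-- The uniform law on the sphere of energy `E` in `ℂⁿ`. -/
def dataLaw (n : ℕ) (E : ℝ) : Measure (Fin n → ℂ) :=
  (sphereLaw n).map fun u => (Real.sqrt E : ℂ) • u

instance (n : ℕ) (E : ℝ) : IsProbabilityMeasure (dataLaw n E) :=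
  Measure.isProbabilityMeasure_map (by fun_prop : Measurable fun u : Fin n → ℂ =>
    (Real.sqrt E : ℂ) • u).aemeasurable

lemma ae_normSq_dataLaw {n : ℕ} [NeZero n] {E : ℝ} (hE : 0 ≤ E) :
    ∀ᵐ x ∂(dataLaw n E), normSq x = E := by
  unfold dataLaw
  rw [ae_map_iff (by fun_prop : Measurable fun u : Fin n → ℂ =>
    (Real.sqrt E : ℂ) • u).aemeasurable (measurableSet_eq_fun (by fun_prop) (by fun_prop))]
  filter_upwards [ae_normSq_sphereLaw n] with u hu
  rw [normSq_smul, hu, Complex.norm_real, Real.norm_of_nonneg (Real.sqrt_nonneg _),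
    Real.sq_sqrt hE, mul_one]

lemma ae_pi_of_ae {ι α : Type*} [Fintype ι] [MeasurableSpace α] {μ : Measure α}
    [IsProbabilityMeasure μ] {p : α → Prop} (h : ∀ᵐ x ∂μ, p x) :
    ∀ᵐ x ∂(Measure.pi fun _ : ι => μ), ∀ i, p (x i) :=
  ae_all_iff.2 fun i => (measurePreserving_eval (fun _ : ι => μ) i).quasiMeasurePreserving.ae h

lemma metricRatio_eq_lintegral_dataLaw {n : ℕ} (E s v : ℝ) (m : ℂ) (x y : Fin n → ℂ) :
    metricRatio E s v m x y = ∫⁻ x', ENNReal.ofReal (Real.exp (s * (metricExp v m x y -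
      metricExp v m x' y))) ∂(dataLaw n E) := by
  have hm : Measurable fun x' : Fin n → ℂ => ENNReal.ofReal (Real.exp (s * (metricExp v m x y -
      metricExp v m x' y))) := by
    have := measurable_metricExp_comp (v := v) (measurable_const (a := m))
      (by fun_prop : Measurable fun u : Fin n → ℂ => u) (measurable_const (a := y))
    fun_prop
  unfold dataLaw metricRatio
  rw [lintegral_map hm (by fun_prop)]

/-- The decoding metric for the blocks of a codeword, given the estimates. -/
def codeMetric (κ e : ℝ) {ℓ n : ℕ} (p : (Fin ℓ → Fin n → ℂ) × (Fin ℓ → ℂ × (Fin n → ℂ))) : ℝ :=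
  ∏ k, mlMetric κ e (p.2 k).1 (p.1 k) (p.2 k).2

lemma measurable_codeMetric {κ e : ℝ} (hκ : 0 ≤ κ) (he : 0 ≤ e) (ℓ n : ℕ) :
    Measurable (codeMetric κ e (ℓ := ℓ) (n := n)) := by
  unfold codeMetric
  simp_rw [mlMetric_eq hκ he]
  refine Finset.measurable_prod _ fun k _ => ?_
  have hmu := measurable_muP κ e
  have h := measurable_metricExp_comp (v := varP κ e)
    (by fun_prop : Measurable fun p : (Fin ℓ → Fin n → ℂ) × (Fin ℓ → ℂ × (Fin n → ℂ)) =>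
      muP κ e (p.2 k).1)
    (by fun_prop : Measurable fun p : (Fin ℓ → Fin n → ℂ) × (Fin ℓ → ℂ × (Fin n → ℂ)) => p.1 k)
    (by fun_prop : Measurable fun p : (Fin ℓ → Fin n → ℂ) × (Fin ℓ → ℂ × (Fin n → ℂ)) =>
      (p.2 k).2)
  fun_prop

/-- Codewords of equal energy share the normalizing constant, so comparing metrics amounts to
comparing sums of quadratic forms. -/
lemma codeMetric_eq {κ e E : ℝ} (hκ : 0 ≤ κ) (he : 0 ≤ e) {ℓ n : ℕ} {x : Fin ℓ → Fin n → ℂ}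
    (hx : ∀ k, normSq (x k) = E) (o : Fin ℓ → ℂ × (Fin n → ℂ)) :
    codeMetric κ e (x, o) =
      Real.exp (-∑ k, metricExp (varP κ e) (muP κ e (o k).1) (x k) (o k).2) /
        (Real.pi ^ n * (1 + varP κ e * E)) ^ ℓ := by
  unfold codeMetric
  simp_rw [mlMetric_eq hκ he, hx]
  rw [Finset.prod_div_distrib, ← Real.exp_sum, Finset.sum_neg_distrib]
  simp

/-- The Chernoff bound on the pairwise error probability. -/
lemma measure_codeMetric_le {κ e E s : ℝ} (hκ : 0 ≤ κ) (he : 0 ≤ e) (hE : 0 ≤ E) (hs : 0 ≤ s)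
    {ℓ n : ℕ} [NeZero n] {x : Fin ℓ → Fin n → ℂ} (hx : ∀ k, normSq (x k) = E)
    (o : Fin ℓ → ℂ × (Fin n → ℂ)) :
    (Measure.pi fun _ : Fin ℓ => dataLaw n E) {x' | codeMetric κ e (x, o) ≤ codeMetric κ e (x', o)}
      ≤ ∏ k, metricRatio E s (varP κ e) (muP κ e (o k).1) (x k) (o k).2 := by
  have hD := measurable_codeMetric hκ he ℓ n
  have hA : MeasurableSet {x' | codeMetric κ e (x, o) ≤ codeMetric κ e (x', o)} :=
    measurableSet_le measurable_const (by fun_prop)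
  simp_rw [metricRatio_eq_lintegral_dataLaw]
  rw [← lintegral_pi_prod ℓ (fun _ => dataLaw n E) (fun k x' => ENNReal.ofReal (Real.exp
    (s * (metricExp (varP κ e) (muP κ e (o k).1) (x k) (o k).2 -
      metricExp (varP κ e) (muP κ e (o k).1) x' (o k).2)))), ← lintegral_indicator_one hA]
  · refine lintegral_mono_ae ?_
    filter_upwards [ae_pi_of_ae (ι := Fin ℓ) (ae_normSq_dataLaw (n := n) hE)] with x' hx'
    -- On this event the `s`-th power of the ratio of metrics is at least one, hence it dominates
    -- the indicator.
    by_cases h : x' ∈ {x' | codeMetric κ e (x, o) ≤ codeMetric κ e (x', o)}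
    · rw [Set.indicator_of_mem h]
      have hle : codeMetric κ e (x, o) ≤ codeMetric κ e (x', o) := h
      have hc : 0 < (Real.pi ^ n * (1 + varP κ e * E)) ^ ℓ := by
        have := varP_pos hκ he
        positivity
      rw [codeMetric_eq hκ he hx, codeMetric_eq hκ he hx', div_le_div_iff_of_pos_right hc,
        Real.exp_le_exp, neg_le_neg_iff] at hle
      rw [← ENNReal.ofReal_prod_of_nonneg fun _ _ => (Real.exp_pos _).le, ← Real.exp_sum,
        ← Finset.mul_sum, Finset.sum_sub_distrib, Pi.one_apply, ENNReal.one_le_ofReal,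
        Real.one_le_exp_iff]
      exact mul_nonneg hs (sub_nonneg.2 hle)
    · rw [Set.indicator_of_notMem h]
      exact zero_le
  · intro k
    have := measurable_metricExp_comp (v := varP κ e) (measurable_const (a := muP κ e (o k).1))
      (by fun_prop : Measurable fun u : Fin n → ℂ => u) (measurable_const (a := (o k).2))
    fun_prop

/-! ### The law of the metric ratio of the transmitted codeword -/

/-- Measurability passes through `metricRatio`, a parameter integral, instead of the Bessel formula.
-/
lemma measurable_infoDens {n : ℕ} [NeZero n] {ρ v s : ℝ} (hρ : 0 ≤ ρ) (hv : 0 < v)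
    (hs : 0 ≤ s) : Measurable fun p : ℂ × (Fin n → ℂ) => infoDens ρ p.1 v s p.2 := by
  have h : (fun p : ℂ × (Fin n → ℂ) => infoDens ρ p.1 v s p.2) = fun p =>
      -Real.log (metricRatio (n * ρ) s v p.1 (Pi.single (0 : Fin n) (Real.sqrt (n * ρ) : ℂ))
        (wTilde ρ p.1 v p.2)).toReal := by
    funext p
    rw [← ofReal_exp_neg_infoDens hρ hv hs, ENNReal.toReal_ofReal (Real.exp_pos _).le,
      Real.log_exp, neg_neg]
  rw [h]
  have h1 := (measurable_metricRatio (n * ρ) s v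
    (Pi.single (0 : Fin n) (Real.sqrt (n * ρ) : ℂ))).comp
      (measurable_fst.prodMk (measurable_wTilde (n := n) ρ v))
  exact (Real.measurable_log.comp h1.ennreal_toReal).neg

/-- For `e = 0` the function `muP` is constant, so the Dirac mass and the Gaussian law (with `0⁻¹ =
0`) are interchangeable. -/
lemma lintegral_estimateLaw_muP (κ e : ℝ) (φ : ℂ → ℝ≥0∞) :
    ∫⁻ h, φ (muP κ e h) ∂(estimateLaw κ e) =
      ∫⁻ h, φ (muP κ e h) ∂(cgauss (muH κ) (varH κ + e⁻¹)) := by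
  by_cases he : e = 0
  · simp [muP, he]
  · rw [estimateLaw, if_neg he]

/-- Conditionally on the estimate this is `fadingLaw_map_metricRatio`; the estimate is then
integrated out. -/
lemma blockLaw_map_metricRatio {np nd : ℕ} [NeZero nd] {κ ρ s : ℝ} (hκ : 0 ≤ κ) (hρ : 0 ≤ ρ)
    (hs : 0 ≤ s) (xp : Fin np → ℂ) {x : Fin nd → ℂ} (hx : normSq x = nd * ρ) :
    (blockLaw κ (np + nd)).map (fun ω => metricRatio (nd * ρ) s (varP κ (normSq xp))
        (muP κ (normSq xp) (blockObs xp x ω).1) x (blockObs xp x ω).2) =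
      ((cgauss (muH κ) (varH κ + (normSq xp)⁻¹)).prod (noiseLaw nd)).map fun p =>
        ENNReal.ofReal (Real.exp
          (-infoDens ρ (muP κ (normSq xp) p.1) (varP κ (normSq xp)) s p.2)) := by
  have he : 0 ≤ normSq xp := normSq_nonneg xp
  set e := normSq xp
  have hv : 0 < varP κ e := varP_pos hκ he
  have hmu := measurable_muP κ e
  have hobs := measurable_blockObs_right xp x
  have hR : Measurable fun p : ℂ × (Fin nd → ℂ) =>
      metricRatio (nd * ρ) s (varP κ e) (muP κ e p.1) x p.2 := by
    have h := (measurable_metricRatio (nd * ρ) s (varP κ e) x).comp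
      ((hmu.comp measurable_fst).prodMk measurable_snd)
    exact h
  have hI : Measurable fun p : ℂ × (Fin nd → ℂ) =>
      ENNReal.ofReal (Real.exp (-infoDens ρ (muP κ e p.1) (varP κ e) s p.2)) := by
    have h := (measurable_infoDens (n := nd) hρ hv hs).comp
      ((hmu.comp measurable_fst).prodMk measurable_snd)
    have h' : Measurable fun p : ℂ × (Fin nd → ℂ) =>
      infoDens ρ (muP κ e p.1) (varP κ e) s p.2 := h
    fun_prop
  have hf : Measurable fun p : ℂ × (ℂ × (Fin nd → ℂ)) =>
      (fun i => (muP κ e p.1 + p.2.1) * x i + p.2.2 i : Fin nd → ℂ) := by fun_prop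
  have hjoint : (blockLaw κ (np + nd)).map (blockObs xp x) =
      estimateLaw κ e ⊗ₘ mapKernel ((cgauss 0 (varP κ e)).prod (noiseLaw nd)) _ hf := by
    rw [compProd_mapKernel]
    exact blockLaw_map_blockObs hκ xp x
  ext t ht
  rw [Measure.map_apply hI ht, Measure.prod_apply (hI ht)]
  have h1 : (blockLaw κ (np + nd)).map (fun ω => metricRatio (nd * ρ) s (varP κ e)
        (muP κ e (blockObs xp x ω).1) x (blockObs xp x ω).2) =
      ((blockLaw κ (np + nd)).map (blockObs xp x)).map fun p =>
        metricRatio (nd * ρ) s (varP κ e) (muP κ e p.1) x p.2 := by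
    rw [Measure.map_map hR hobs]
    rfl
  rw [h1, hjoint, Measure.map_apply hR ht, Measure.compProd_apply (hR ht)]
  refine Eq.trans (lintegral_congr fun h => ?_) (lintegral_estimateLaw_muP κ e fun m =>
    noiseLaw nd ((fun w => ENNReal.ofReal (Real.exp (-infoDens ρ m (varP κ e) s w))) ⁻¹' t))
  have hK : mapKernel ((cgauss 0 (varP κ e)).prod (noiseLaw nd)) _ hf h =
      fadingLaw (muP κ e h) (varP κ e) x := (fadingLaw_eq_map (muP κ e h) hv.le x).symm
  rw [hK]
  have hRh : Measurable (metricRatio (nd * ρ) s (varP κ e) (muP κ e h) x) := by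
    have h' := hR.comp (measurable_prodMk_left (x := h))
    exact h'
  have hIh : Measurable fun w : Fin nd → ℂ =>
      ENNReal.ofReal (Real.exp (-infoDens ρ (muP κ e h) (varP κ e) s w)) := by
    have h' := hI.comp (measurable_prodMk_left (x := h))
    exact h'
  have h2 := congrArg (fun μ => μ t) (fadingLaw_map_metricRatio hρ hv hs (muP κ e h) hx)
  simp only [Measure.map_apply hRh ht, Measure.map_apply hIh ht] at h2
  exact h2

/-! ### The truncated union bound as an expectation -/

lemma rcusTerm_nonneg (M : ℕ) (i : ℝ) : 0 ≤ rcusTerm M i := by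
  unfold rcusTerm
  split_ifs <;> positivity

lemma rcusTerm_le_one (M : ℕ) (i : ℝ) : rcusTerm M i ≤ 1 := by
  unfold rcusTerm
  split_ifs
  · exact zero_le_one
  · rw [Real.exp_le_one_iff, neg_nonpos]
    exact le_max_left _ _

lemma measurable_rcusTerm (M : ℕ) : Measurable (rcusTerm M) := by
  unfold rcusTerm
  split_ifs <;> fun_prop

/-- Here `M` counts the competitors, hence `M + 1` messages. For `M = 0` both sides vanish, in
accordance with `log 0 = -∞`. -/
lemma min_one_mul_prod_exp {ℓ : ℕ} (M : ℕ) (i : Fin ℓ → ℝ) :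
    min 1 ((M : ℝ≥0∞) * ∏ k, ENNReal.ofReal (Real.exp (-i k))) =
      ENNReal.ofReal (rcusTerm (M + 1) (∑ k, i k)) := by
  rw [← ENNReal.ofReal_prod_of_nonneg fun _ _ => (Real.exp_pos _).le, ← Real.exp_sum,
    Finset.sum_neg_distrib]
  unfold rcusTerm
  rcases Nat.eq_zero_or_pos M with rfl | hM
  · simp
  · have hM' : (0 : ℝ) < M := by exact_mod_cast hM
    rw [if_neg (by omega), ← ENNReal.ofReal_natCast, ← ENNReal.ofReal_mul hM'.le,
      ← ENNReal.ofReal_one, ← ENNReal.ofReal_min]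
    congr 1
    push_cast
    rw [add_sub_cancel_right, ← min_neg_neg, neg_zero, neg_sub, (Real.exp_monotone).map_min,
      Real.exp_zero, sub_eq_add_neg, Real.exp_add, Real.exp_log hM']

/-- The blocks are independent, so equality of the laws of the ratios block by block gives equality
of the joint laws. -/
lemma lintegral_min_prod_metricRatio {ℓ np nd : ℕ} [NeZero nd] {κ ρ e s : ℝ} (hκ : 0 ≤ κ)
    (hρ : 0 ≤ ρ) (hs : 0 ≤ s) (M : ℕ) {xp : Fin ℓ → Fin np → ℂ} (hxp : ∀ k, normSq (xp k) = e)
    (he : 0 ≤ e) {x : Fin ℓ → Fin nd → ℂ} (hx : ∀ k, normSq (x k) = nd * ρ) :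
    ∫⁻ ω, min 1 ((M : ℝ≥0∞) * ∏ k, metricRatio (nd * ρ) s (varP κ e)
        (muP κ e (blockObs (xp k) (x k) (ω k)).1) (x k) (blockObs (xp k) (x k) (ω k)).2)
        ∂(Measure.pi fun _ : Fin ℓ => blockLaw κ (np + nd)) =
      ENNReal.ofReal (∫ ω, rcusTerm (M + 1)
        (∑ k, infoDens ρ (muP κ e (ω k).1) (varP κ e) s (ω k).2) ∂(estimateNoiseLaw κ e ℓ nd)) := by
  have hv : 0 < varP κ e := varP_pos hκ he
  have hmu := measurable_muP κ e
  have hR : ∀ k, Measurable fun ω : ℂ × (Fin (np + nd) → ℂ) => metricRatio (nd * ρ) s (varP κ e)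
      (muP κ e (blockObs (xp k) (x k) ω).1) (x k) (blockObs (xp k) (x k) ω).2 := by
    intro k
    have hobs := measurable_blockObs_right (xp k) (x k)
    have h := (measurable_metricRatio (nd * ρ) s (varP κ e) (x k)).comp
      ((hmu.comp (measurable_fst.comp hobs)).prodMk (measurable_snd.comp hobs))
    exact h
  have hI : Measurable fun p : ℂ × (Fin nd → ℂ) =>
      infoDens ρ (muP κ e p.1) (varP κ e) s p.2 := by
    have h := (measurable_infoDens (n := nd) hρ hv hs).comp
      ((hmu.comp measurable_fst).prodMk measurable_snd)
    exact h
  have hΦ : Measurable fun r : Fin ℓ → ℝ≥0∞ => min 1 ((M : ℝ≥0∞) * ∏ k, r k) := by fun_prop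
  set F : Fin ℓ → ℂ × (Fin (np + nd) → ℂ) → ℝ≥0∞ := fun k ω => metricRatio (nd * ρ) s (varP κ e)
      (muP κ e (blockObs (xp k) (x k) ω).1) (x k) (blockObs (xp k) (x k) ω).2
  set G : ℂ × (Fin nd → ℂ) → ℝ≥0∞ := fun p =>
    ENNReal.ofReal (Real.exp (-infoDens ρ (muP κ e p.1) (varP κ e) s p.2))
  have hG : Measurable G := by fun_prop
  have hFG : ∀ k, (blockLaw κ (np + nd)).map (F k) =
      ((cgauss (muH κ) (varH κ + e⁻¹)).prod (noiseLaw nd)).map G := by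
    intro k
    have h := blockLaw_map_metricRatio hκ hρ hs (xp k) (hx k)
    rw [hxp k] at h
    exact h
  have hFp : ∀ k, IsProbabilityMeasure ((blockLaw κ (np + nd)).map (F k)) := fun k =>
    Measure.isProbabilityMeasure_map (hR k).aemeasurable
  have hGp : IsProbabilityMeasure (((cgauss (muH κ) (varH κ + e⁻¹)).prod (noiseLaw nd)).map G) :=
    Measure.isProbabilityMeasure_map hG.aemeasurable
  have h1 : (Measure.pi fun _ : Fin ℓ => blockLaw κ (np + nd)).map (fun ω k => F k (ω k)) =
      (estimateNoiseLaw κ e ℓ nd).map fun ω k => G (ω k) := by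
    rw [Measure.pi_map_pi fun k => (hR k).aemeasurable]
    unfold estimateNoiseLaw
    rw [Measure.pi_map_pi fun k => hG.aemeasurable]
    congr 1
    funext k
    exact hFG k
  have hFm : Measurable fun (ω : Fin ℓ → ℂ × (Fin (np + nd) → ℂ)) k => F k (ω k) :=
    measurable_pi_lambda _ fun k => (hR k).comp (measurable_pi_apply k)
  have hGm : Measurable fun (ω : Fin ℓ → ℂ × (Fin nd → ℂ)) k => G (ω k) :=
    measurable_pi_lambda _ fun k => hG.comp (measurable_pi_apply k)
  have h2 := lintegral_map (μ := Measure.pi fun _ : Fin ℓ => blockLaw κ (np + nd)) hΦ hFm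
  have h3 := lintegral_map (μ := estimateNoiseLaw κ e ℓ nd) hΦ hGm
  rw [h1] at h2
  refine h2.symm.trans (h3.trans ?_)
  have hprob : IsProbabilityMeasure (estimateNoiseLaw κ e ℓ nd) := by
    unfold estimateNoiseLaw; infer_instance
  have hmeas : Measurable fun ω : Fin ℓ → ℂ × (Fin nd → ℂ) => rcusTerm (M + 1)
      (∑ k, infoDens ρ (muP κ e (ω k).1) (varP κ e) s (ω k).2) :=
    (measurable_rcusTerm _).comp (Finset.measurable_sum _ fun k _ =>
      hI.comp (measurable_pi_apply k))
  rw [ofReal_integral_eq_lintegral_ofReal]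
  · exact lintegral_congr fun ω => min_one_mul_prod_exp M _
  · refine Integrable.of_bound hmeas.aestronglyMeasurable 1 (Filter.Eventually.of_forall fun ω => ?_)
    rw [Real.norm_of_nonneg (rcusTerm_nonneg _ _)]
    exact rcusTerm_le_one _ _
  · exact Filter.Eventually.of_forall fun ω => rcusTerm_nonneg _ _

/-! ### The coding theorem -/

lemma normSq_append {m n : ℕ} (x : Fin m → ℂ) (y : Fin n → ℂ) :
    normSq (Fin.append x y) = normSq x + normSq y := by
  simp [normSq, Fin.sum_univ_add]

lemma pilotPart_append {m n : ℕ} (x : Fin m → ℂ) (y : Fin n → ℂ) :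
    pilotPart (Fin.append x y) = x := by
  funext i
  simp [pilotPart]

lemma dataPart_append {m n : ℕ} (x : Fin m → ℂ) (y : Fin n → ℂ) :
    dataPart (Fin.append x y) = y := by
  funext i
  simp [dataPart]

@[fun_prop]
lemma measurable_dataPart {m n : ℕ} :
    Measurable (dataPart : (Fin (m + n) → ℂ) → Fin n → ℂ) := by
  unfold dataPart
  fun_prop

/-- The estimates and the data parts of the channel outputs. -/
def codeObs {ℓ np nd : ℕ} (xp : Fin ℓ → Fin np → ℂ)
    (p : (Fin ℓ → Fin nd → ℂ) × (Fin ℓ → ℂ × (Fin (np + nd) → ℂ))) :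
    Fin ℓ → ℂ × (Fin nd → ℂ) := fun k => blockObs (xp k) (p.1 k) (p.2 k)

lemma measurable_codeObs {ℓ np nd : ℕ} (xp : Fin ℓ → Fin np → ℂ) :
    Measurable (codeObs (nd := nd) xp) := by
  refine measurable_pi_lambda _ fun k => ?_
  have h := (measurable_blockObs (nd := nd) (xp k)).comp
    (by fun_prop : Measurable fun p : (Fin ℓ → Fin nd → ℂ) × (Fin ℓ → ℂ × (Fin (np + nd) → ℂ)) =>
      (p.1 k, p.2 k))
  exact h

/-- The left side does not involve `s`: one ensemble satisfies the Chernoff bound for every `s`,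
hence also the infimum. -/
lemma lintegral_min_measure_codeMetric_le {ℓ np nd : ℕ} [NeZero nd] {κ ρp ρd : ℝ} (hκ : 0 ≤ κ)
    (hρp : 0 ≤ ρp) (hρd : 0 ≤ ρd) (M : ℕ) {xp : Fin ℓ → Fin np → ℂ}
    (hxp : ∀ k, normSq (xp k) = np * ρp) {x : Fin ℓ → Fin nd → ℂ}
    (hx : ∀ k, normSq (x k) = nd * ρd) :
    ∫⁻ ω, min 1 ((M : ℝ≥0∞) * (Measure.pi fun _ : Fin ℓ => dataLaw nd (nd * ρd))
      {x' | codeMetric κ (np * ρp) (x, codeObs xp (x, ω)) ≤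
        codeMetric κ (np * ρp) (x', codeObs xp (x, ω))})
        ∂(Measure.pi fun _ : Fin ℓ => blockLaw κ (np + nd)) ≤
      ENNReal.ofReal (epsUb κ ℓ np nd (M + 1) ρp ρd) := by
  have he : 0 ≤ (np : ℝ) * ρp := by positivity
  have hE : 0 ≤ (nd : ℝ) * ρd := by positivity
  set I := ∫⁻ ω, min 1 ((M : ℝ≥0∞) * (Measure.pi fun _ : Fin ℓ => dataLaw nd (nd * ρd))
      {x' | codeMetric κ (np * ρp) (x, codeObs xp (x, ω)) ≤
        codeMetric κ (np * ρp) (x', codeObs xp (x, ω))})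
        ∂(Measure.pi fun _ : Fin ℓ => blockLaw κ (np + nd))
  have hI : I ≤ 1 := (lintegral_mono fun ω => min_le_left _ _).trans (by simp)
  have hItop : I ≠ ⊤ := ne_top_of_le_ne_top ENNReal.one_ne_top hI
  rw [← ENNReal.ofReal_toReal hItop]
  refine ENNReal.ofReal_le_ofReal (le_ciInf fun s => ?_)
  refine ENNReal.toReal_le_of_le_ofReal
    (integral_nonneg fun ω => rcusTerm_nonneg _ _) ?_
  refine le_trans ?_ (lintegral_min_prod_metricRatio hκ hρd s.2 M hxp he hx).le
  refine lintegral_mono fun ω => min_le_min le_rfl ?_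
  gcongr
  exact measure_codeMetric_le hκ he hE s.2 hx _

/-- Some codebook does not exceed the mean of the summed error bounds, and it can be chosen off the
null set where the energy constraint fails. -/
lemma exists_codebook {ℓ np nd : ℕ} [NeZero nd] {κ ρp ρd : ℝ} (hκ : 0 ≤ κ)
    (hρp : 0 ≤ ρp) (hρd : 0 ≤ ρd) (M : ℕ) {xp : Fin ℓ → Fin np → ℂ}
    (hxp : ∀ k, normSq (xp k) = np * ρp) :
    ∃ c : Fin (M + 1) → Fin ℓ → Fin nd → ℂ, (∀ j k, normSq (c j k) = nd * ρd) ∧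
      ∑ j, (Measure.pi fun _ : Fin ℓ => blockLaw κ (np + nd))
        {ω | ∃ i, i ≠ j ∧ codeMetric κ (np * ρp) (c j, codeObs xp (c j, ω)) ≤
          codeMetric κ (np * ρp) (c i, codeObs xp (c j, ω))} ≤
        (M + 1 : ℕ) * ENNReal.ofReal (epsUb κ ℓ np nd (M + 1) ρp ρd) := by
  have he : 0 ≤ (np : ℝ) * ρp := by positivity
  have hE : 0 ≤ (nd : ℝ) * ρd := by positivity
  set P := Measure.pi fun _ : Fin ℓ => blockLaw κ (np + nd)
  set Q := Measure.pi fun _ : Fin ℓ => dataLaw nd (nd * ρd)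
  have hD := measurable_codeMetric hκ he ℓ nd
  have hout := measurable_codeObs (nd := nd) xp
  have hQ : ∀ᵐ x ∂Q, ∀ k, normSq (x k) = nd * ρd := ae_pi_of_ae (ae_normSq_dataLaw hE)
  have hB := random_coding_union_bound P Q hout hD (M := M)
    (B := ENNReal.ofReal (epsUb κ ℓ np nd (M + 1) ρp ρd)) (by
      filter_upwards [hQ] with x hx
      exact lintegral_min_measure_codeMetric_le hκ hρp hρd M hxp hx)
  have hmeas : ∀ j : Fin (M + 1), Measurable fun c : Fin (M + 1) → Fin ℓ → Fin nd → ℂ =>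
      P {ω | ∃ i, i ≠ j ∧ codeMetric κ (np * ρp) (c j, codeObs xp (c j, ω)) ≤
          codeMetric κ (np * ρp) (c i, codeObs xp (c j, ω))} := by
    intro j
    have hS : MeasurableSet {q : (Fin (M + 1) → Fin ℓ → Fin nd → ℂ) ×
        (Fin ℓ → ℂ × (Fin (np + nd) → ℂ)) | ∃ i, i ≠ j ∧
          codeMetric κ (np * ρp) (q.1 j, codeObs xp (q.1 j, q.2)) ≤
          codeMetric κ (np * ρp) (q.1 i, codeObs xp (q.1 j, q.2))} := by
      have hm : ∀ i, Measurable fun q : (Fin (M + 1) → Fin ℓ → Fin nd → ℂ) ×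
          (Fin ℓ → ℂ × (Fin (np + nd) → ℂ)) =>
          codeMetric κ (np * ρp) (q.1 i, codeObs xp (q.1 j, q.2)) := fun i => by fun_prop
      rw [Set.ofPred_exists]
      exact MeasurableSet.iUnion fun i => (MeasurableSet.const (i ≠ j)).inter
        (measurableSet_le (hm j) (hm i))
    exact measurable_measure_prodMk_left hS
  have hnull : (Measure.pi fun _ : Fin (M + 1) => Q)
      {c | ¬ ∀ j k, normSq (c j k) = nd * ρd} = 0 := ae_pi_of_ae hQ
  obtain ⟨c, hc, hle⟩ := exists_notMem_null_le_lintegral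
    (Finset.measurable_sum Finset.univ fun j _ => hmeas j).aemeasurable hnull
  refine ⟨c, not_not.1 hc, hle.trans ?_⟩
  rw [lintegral_finsetSum _ fun j _ => hmeas j]
  exact (Finset.sum_le_sum fun j _ => hB j).trans (by simp)

lemma exists_pilotAssisted_code {ℓ np nd : ℕ} [NeZero nd] {κ ρ ρp ρd : ℝ} (hκ : 0 ≤ κ)
    (hρp : 0 ≤ ρp) (hρd : 0 ≤ ρd)
    (hρ : (np : ℝ) * ρp + (nd : ℝ) * ρd = ((np + nd : ℕ) : ℝ) * ρ) {M : ℕ} (hM : 1 ≤ M)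
    {xp : Fin ℓ → Fin np → ℂ} (hxp : ∀ k, normSq (xp k) = np * ρp) :
    ∃ c : BlockCode ℓ (np + nd) M ρ, IsPilotAssisted c xp ρd ∧
      IsMLGivenEstimate κ (np * ρp) c xp ∧ avgError κ c ≤ epsUb κ ℓ np nd M ρp ρd := by
  obtain ⟨M, rfl⟩ := Nat.exists_eq_succ_of_ne_zero (Nat.one_le_iff_ne_zero.1 hM)
  have he : 0 ≤ (np : ℝ) * ρp := by positivity
  obtain ⟨c, hc, hle⟩ := exists_codebook (ℓ := ℓ) (nd := nd) hκ hρp hρd M hxp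
  have hD := measurable_codeMetric hκ he ℓ nd
  obtain ⟨d, hd, hmax⟩ := exists_measurable_argmax (Nat.succ_pos M)
    (g := fun i o => codeMetric κ (np * ρp) (c i, o)) (fun i => by fun_prop)
  let obs : (Fin ℓ → Fin (np + nd) → ℂ) → Fin ℓ → ℂ × (Fin nd → ℂ) := fun y k =>
    (mlEstimate (xp k) (pilotPart (y k)), dataPart (y k))
  have hobs : Measurable obs := by
    simp only [obs, mlEstimate, pilotPart, dotProduct, Pi.star_apply]
    fun_prop
  let C : BlockCode ℓ (np + nd) (M + 1) ρ :=
    { enc := fun m k => Fin.append (xp k) (c m k)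
      power := fun m k => by rw [normSq_append, hxp, hc, hρ]
      dec := d ∘ obs
      measurable_dec := hd.comp hobs }
  have hdata : ∀ m k, dataPart (C.enc m k) = c m k := fun m k => dataPart_append _ _
  refine ⟨C, fun m k => ⟨pilotPart_append _ _, by rw [hdata, hc]⟩, fun y m => ?_, ?_⟩
  · simp only [hdata]
    exact hmax (obs y) m
  set P := Measure.pi fun _ : Fin ℓ => blockLaw κ (np + nd)
  set ε := epsUb κ ℓ np nd (M + 1) ρp ρd
  have hε : 0 ≤ ε := Real.iInf_nonneg fun s => integral_nonneg fun ω => rcusTerm_nonneg _ _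
  have herr : ∀ j, outputLaw κ (C.enc j) {y | C.dec y ≠ j} ≤
      P {ω | ∃ i, i ≠ j ∧ codeMetric κ (np * ρp) (c j, codeObs xp (c j, ω)) ≤
          codeMetric κ (np * ρp) (c i, codeObs xp (c j, ω))} := by
    intro j
    have hset : MeasurableSet {y | C.dec y ≠ j} :=
      (C.measurable_dec (measurableSet_singleton j)).compl
    unfold outputLaw
    rw [Measure.map_apply (by fun_prop) hset]
    -- A wrongly decoded message is itself a competitor with metric at least that of `j`; ties are
    -- counted as errors.
    exact measure_mono fun ω hω => ⟨_, hω, hmax _ j⟩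
  have hprob : ∀ j, IsProbabilityMeasure (outputLaw κ (C.enc j)) := fun j => by
    unfold outputLaw
    exact Measure.isProbabilityMeasure_map
      (by fun_prop : Measurable fun (ω : Fin ℓ → ℂ × (Fin (np + nd) → ℂ)) k i =>
        (ω k).1 * C.enc j k i + (ω k).2 i).aemeasurable
  have hsum : ∑ j, (outputLaw κ (C.enc j)).real {y | C.dec y ≠ j} ≤ (M + 1 : ℕ) * ε := by
    unfold Measure.real
    rw [← ENNReal.toReal_sum fun j _ => measure_ne_top _ _]
    refine ENNReal.toReal_le_of_le_ofReal (by positivity) ?_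
    rw [ENNReal.ofReal_mul (by positivity), ENNReal.ofReal_natCast]
    exact (Finset.sum_le_sum fun j _ => herr j).trans hle
  unfold avgError
  have hMpos : (0 : ℝ) < (M + 1 : ℕ) := by positivity
  rw [one_div, inv_mul_le_iff₀ hMpos]
  exact hsum

end RicianPAT

end

open RicianPAT

theorem mainTheorem5 (κ : ℝ) (hκ : 0 ≤ κ) (ℓ np nd : ℕ) (hℓ : 0 < ℓ) (hnd : 0 < nd)
    (ρ ρp ρd : ℝ) (hρp : 0 ≤ ρp) (hρd : 0 ≤ ρd)
    (hρ : (np : ℝ) * ρp + (nd : ℝ) * ρd = ((np + nd : ℕ) : ℝ) * ρ) :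
    -- the law of the estimate, and the equivalent Rician channel given the estimate
    (∀ (xp : Fin np → ℂ) (xd : Fin nd → ℂ), (∀ i, ‖xp i‖ ^ 2 = ρp) →
      let Y : ℂ × (Fin (np + nd) → ℂ) → Fin (np + nd) → ℂ :=
        fun ω i => ω.1 * Fin.append xp xd i + ω.2 i
      let Hhat : ℂ × (Fin (np + nd) → ℂ) → ℂ := fun ω => mlEstimate xp (pilotPart (Y ω))
      (0 < (np : ℝ) * ρp →
        (blockLaw κ (np + nd)).map Hhat = cgauss (muH κ) (varH κ + ((np : ℝ) * ρp)⁻¹)) ∧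
      ∀ᵐ h ∂((blockLaw κ (np + nd)).map Hhat),
        condDistrib (fun ω => dataPart (Y ω)) Hhat (blockLaw κ (np + nd)) h
          = eqChannelLaw κ (np * ρp) h xd) ∧
    -- the decoding metric is the density of the equivalent channel
    (∀ (h : ℂ) (xd : Fin nd → ℂ), eqChannelLaw κ (np * ρp) h xd =
      volume.withDensity fun y => ENNReal.ofReal (mlMetric κ (np * ρp) h xd y)) ∧
    -- a pilot-assisted code with the maximum-likelihood decoder given the estimates
    (∀ M : ℕ, 1 ≤ M → ∀ xp : Fin ℓ → Fin np → ℂ, (∀ k i, ‖xp k i‖ ^ 2 = ρp) →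
      ∃ c : BlockCode ℓ (np + nd) M ρ, IsPilotAssisted c xp ρd ∧
        IsMLGivenEstimate κ (np * ρp) c xp ∧ avgError κ c ≤ epsUb κ ℓ np nd M ρp ρd) ∧
    -- the lower bound on the maximum coding rate
    ∀ ε : ℝ, sSup {r : EReal | ∃ M : ℕ, 1 ≤ M ∧ epsUb κ ℓ np nd M ρp ρd ≤ ε ∧
        r = ((Real.logb 2 M / (ℓ * (np + nd : ℕ)) : ℝ) : EReal)}
      ≤ maxRate κ ℓ (np + nd) ε ρ := by
  have hnz : NeZero nd := ⟨hnd.ne'⟩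
  have he : 0 ≤ (np : ℝ) * ρp := by positivity
  have henergy : ∀ xp : Fin np → ℂ, (∀ i, ‖xp i‖ ^ 2 = ρp) → normSq xp = np * ρp := by
    intro xp hxp
    simp [normSq, hxp]
  have hcode : ∀ M : ℕ, 1 ≤ M → ∀ xp : Fin ℓ → Fin np → ℂ, (∀ k i, ‖xp k i‖ ^ 2 = ρp) →
      ∃ c : BlockCode ℓ (np + nd) M ρ, IsPilotAssisted c xp ρd ∧
        IsMLGivenEstimate κ (np * ρp) c xp ∧ avgError κ c ≤ epsUb κ ℓ np nd M ρp ρd :=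
    fun M hM xp hxp => exists_pilotAssisted_code hκ hρp hρd hρ hM fun k => henergy _ (hxp k)
  refine ⟨fun xp xd hxp => ?_, fun h xd => eqChannelLaw_eq_withDensity hκ he h xd, hcode,
    fun ε => sSup_le ?_⟩
  · intro Y Hhat
    have hxe := henergy xp hxp
    refine ⟨fun hpos => ?_, ?_⟩
    · have h := blockLaw_map_fst_blockObs hκ xp xd
      rw [hxe, estimateLaw, if_neg hpos.ne'] at h
      exact h
    · have h := condDistrib_blockObs hκ xp xd
      rw [hxe] at h
      exact h
  · rintro r ⟨M, hM, hε, rfl⟩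
    -- Any admissible pilots would do; constant entries `√ρp` show that some exist.
    obtain ⟨c, -, -, hc⟩ := hcode M hM (fun _ _ => (Real.sqrt ρp : ℂ)) fun _ _ => by
      rw [Complex.norm_real, Real.norm_of_nonneg (Real.sqrt_nonneg _), Real.sq_sqrt hρp]
    exact le_sSup ⟨M, c, hc.trans hε, rfl⟩
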